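/- Consider a sphere at position $\vec x\in\mathbb R^3$ driven by a force $\vec f(t)=(f_x,f_y,f_z)\in\mathbb R^3$ and one passive tracer at relative position $\vec r\in\mathbb R^3$ (measured from the centre of the sphere), advected by the Stokeslet flow of the sphere. In dimensionless form this is the driftless control-affine system $$\frac{d\vec r}{dt}=\frac34\Big(\frac{I}{\|\vec r\|}+\frac{\vec r\vec r^{T}}{\|\vec r\|^{3}}\Big)\vec f-\vec f,\qquad \frac{d\vec x}{dt}=\vec f,\qquad\text{i.e.}\qquad \frac{dX}{dt}=\sum_{i\in\{x,y,z\}}f_i(t)\,g_i(X),\quad X=(\vec r,\vec x)\in\mathbb R^6 .$$ Let the state space be $P=P_\rho=\{X\in\mathbb R^6:\|\vec r\|>\rho\}$, where $\rho\ge0$ is arbitrary ($\rho=1$ expresses that the tracer lies outside the unit sphere). A trajectory on $[0,T]$ is a continuous $X:[0,T]\to P$ satisfying $X(t)=X(0)+\int_0^t\sum_i f_i(s)g_i(X(s))\,ds$ with an integrable control $\vec f$. The system is controllable within $Q\subseteq P$ if for all $X_0,X_1\in Q$ and $T>0$ some essentially bounded control admits a trajectory in $P$ with $X(0)=X_0$,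 $X(T)=X_1$. With $[V,W]=(DW)V-(DV)W$, call the $g_i$ the brackets of order $1$ and the bracket of one of order $p$ with one of order $q$ a bracket of order $p+q$. Let $B(X)$ be the span at $X$ of all iterated brackets, and let the controllable state set be $S=\{X\in P:\dim B(X)=6\}$. Then: 1. $S=\{X\in P:\|\vec r\|\ne 3/2\}$. 2. The system is controllable within every connected subset of $S$; in particular it is controllable within $\{X\in P:\|\vec r\|<3/2\}$ and within $\{X\in P:\|\vec r\|>3/2\}$. 3. Along every trajectory, for every integrable control, $\dfrac{d\|\vec r\|^2}{dt}=\dfrac{3-2\|\vec r\|}{\|\vec r\|}\,\vec r\cdot\vec f$ for almost every $t$, which vanishes for every $\vec f$ if $\|\vec r\|=3/2$; and if $\|\vec r\|=3/2$ at one time then $\|\vec r\|=3/2$ at all times. Hence the system is not controllable within any $Q\subseteq P$ that contains both a state with $\|\vec r\|=3/2$ and a state with $\|\vec r\|\neq3/2$; in particular it is not controllable within $U\cap P$ for any neighbourhood $U$ of a state of $P$ with $\|\vec r\|=3/2$. 4. At every state with $\vec r\ne0$, the brackets of order at most $3$ span $\mathbb R^6$ if and only if $\|\vec r\|\notin\{3/2,9/8\}$,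 and the brackets of order at most $4$ span $\mathbb R^6$ if and only if $\|\vec r\|\ne3/2$. 5. At a reduced configuration $\vec r=r\vec e_x$, $r>0$, $\vec x$ arbitrary, the six vectors $g_x,\ g_y,\ g_z,\ [g_x,g_y],\ [g_x,g_z],\ [g_y,[g_x,g_y]]$ span $\mathbb R^6$ if and only if $r\notin\{3/2,9/8\}$. At $r=9/8$, the vectors $g_x,\ g_y,\ g_z,\ [g_x,[g_x,g_y]],\ [g_x,[g_x,g_z]]$ together with either one of the fourth-order brackets $[g_y,[g_x,[g_x,g_y]]]$ and $[g_x,[g_y,[g_x,g_y]]]$ span $\mathbb R^6$. -/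

import Mathlib

open MeasureTheory Set Topology

noncomputable section

/-! ### Driftless control-affine systems `dX/dt = ∑ i, fᵢ(t) gᵢ(X)` -/

section ControlSystem

variable {ι E : Type*} [Fintype ι] [NormedAddCommGroup E] [NormedSpace ℝ E]

/-- `X` is a trajectory on `[0, T]`, staying in the state space `P`, of the system
`dX/dt = ∑ i, fᵢ(t) gᵢ(X)` driven by the integrable control `f` (Carathéodory solution: `X` is
continuous and satisfies the integral form of the equation). -/
structure IsTrajectory (g : ι → E → E) (P : Set E) (T : ℝ)
    (f : ℝ → EuclideanSpace ℝ ι) (X : ℝ → E) : Prop where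
  control_integrable : IntervalIntegrable f volume 0 T
  continuousOn : ContinuousOn X (Icc 0 T)
  mem : ∀ t ∈ Icc 0 T, X t ∈ P
  eq_integral : ∀ t ∈ Icc 0 T, X t = X 0 + ∫ s in (0 : ℝ)..t, ∑ i, f s i • g i (X s)

/-- The system with state space `P` is controllable within `Q`: any two states of `Q` can be
joined, in any prescribed time `T > 0`, by a trajectory in `P` with an essentially bounded
control. -/
def IsControllableWithin (g : ι → E → E) (P Q : Set E) : Prop :=
  ∀ X₀ ∈ Q, ∀ X₁ ∈ Q, ∀ T : ℝ, 0 < T →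
    ∃ (f : ℝ → EuclideanSpace ℝ ι) (X : ℝ → E),
      MemLp f ⊤ (volume.restrict (Icc 0 T)) ∧ IsTrajectory g P T f X ∧ X 0 = X₀ ∧ X T = X₁

/-- `IsIteratedBracket g p V`: the vector field `V` is an iterated Lie bracket of order `p` of
the fields `gᵢ`; the fields themselves are the brackets of order one. Here
`lieBracket ℝ V W X = DW(X) V(X) - DV(X) W(X)`. -/
inductive IsIteratedBracket (g : ι → E → E) : ℕ → (E → E) → Prop
  | field (i : ι) : IsIteratedBracket g 1 (g i)
  | bracket {p q : ℕ} {V W : E → E} (hV : IsIteratedBracket g p V)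
      (hW : IsIteratedBracket g q W) :
      IsIteratedBracket g (p + q) (VectorField.lieBracket ℝ V W)

/-- The span at the state `X` of all iterated brackets of order at most `p`. -/
def bracketSpanUpTo (g : ι → E → E) (p : ℕ) (X : E) : Submodule ℝ E :=
  Submodule.span ℝ {v | ∃ q ≤ p, ∃ V, IsIteratedBracket g q V ∧ v = V X}

/-- The span `B(X)` at the state `X` of all iterated brackets, of any order. -/
def bracketSpan (g : ι → E → E) (X : E) : Submodule ℝ E :=
  Submodule.span ℝ {v | ∃ q V, IsIteratedBracket g q V ∧ v = V X}

/-- The controllable state set: the states of `P` at which `dim B(X)` is the full dimension. -/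
def controllableStateSet (g : ι → E → E) (P : Set E) : Set E :=
  {X ∈ P | Module.finrank ℝ (bracketSpan g X) = Module.finrank ℝ E}

end ControlSystem

/-! ### The force-driven sphere and one passive tracer, with Stokeslet flow -/

/-- Euclidean space `ℝ³`; the indices `0, 1, 2` stand for `x, y, z`. -/
abbrev E3 : Type := EuclideanSpace ℝ (Fin 3)

/-- A state `(r, x)`: position `r` of the tracer relative to the sphere, and position `x` of the
sphere. -/
abbrev TracerState : Type := E3 × E3

/-- The dimensionless Stokeslet velocity `(3/4) (I / ‖r‖ + r rᵀ / ‖r‖³) f`. -/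
def stokeslet (r f : E3) : E3 :=
  (3 / 4 : ℝ) • ((1 / ‖r‖) • f + (inner ℝ r f / ‖r‖ ^ 3) • r)

/-- The control fields: the system is `dr/dt = stokeslet r f - f`, `dx/dt = f`, and the `i`-th
field is the one multiplying the component `fᵢ` of the force. -/
def tracerField (i : Fin 3) (X : TracerState) : TracerState :=
  (stokeslet X.1 (EuclideanSpace.single i 1) - EuclideanSpace.single i 1,
    EuclideanSpace.single i 1)

/-- The state space: the tracer is at distance greater than `ρ` from the centre of the sphere. -/
def tracerStates (ρ : ℝ) : Set TracerState := {X | ρ < ‖X.1‖}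

/-- `gBr i j = [g_i, g_j]` for the tracer fields. -/
def gBr (i j : Fin 3) : TracerState → TracerState :=
  VectorField.lieBracket ℝ (tracerField i) (tracerField j)

/-- `gBr₃ i j k = [g_i, [g_j, g_k]]` for the tracer fields. -/
def gBr₃ (i j k : Fin 3) : TracerState → TracerState :=
  VectorField.lieBracket ℝ (tracerField i) (gBr j k)

/-- `gBr₄ i j k l = [g_i, [g_j, [g_k, g_l]]]` for the tracer fields. -/
def gBr₄ (i j k l : Fin 3) : TracerState → TracerState :=
  VectorField.lieBracket ℝ (tracerField i) (gBr₃ j k l)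

end

/-!
Let `s = ‖r‖`. In `dr/dt = stokeslet r f - f` the velocity is `3 / (2 s) - 1` times the force if the
force is radial, and `3 / (4 s) - 1` times the force if it is orthogonal to `r`.

*Brackets.* Since `dx/dt = f`, brackets of order at least two have no sphere component, so only
their tracer component, a vector field in `r`, matters. Those of order two are multiples
`rotCoeff s` of the rotation fields (`gBr_eq`), the coefficient vanishing only at `s = 9 / 8`. For
higher orders it is enough to follow the function `radialPart V = ⟪r, v⟫`, because
`radialPart [V, W] = D (radialPart W) V - D (radialPart V) W` needs no derivatives of the fields
beyond those of their radial parts (`radialPart_lieBracket`). It gives the radial part of the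
brackets of order three in general and of order four at `s = 9 / 8`, where those of order three
supply the rotation directions (`gBr₃_eq`), and it shows by induction that all brackets are tangent
to the sphere `s = 3 / 2`. A span is everything as soon as it contains the three fields, the rotation directions
and one vector without sphere component that is not orthogonal to `r`
(`eq_top_of_perp_of_radial`).

*Invariance of `s = 3 / 2`.* The function `s² - 9 / 4` is absolutely continuous along a trajectory
and satisfies a scalar linear equation with integrable coefficient, so that it vanishes everywhere
or nowhere (`eq_zero_of_ae_hasDerivAt_mul`).

*Controllability.* No general orbit theorem is needed. Moving the tracer radially from `s₀ n` to
`s₁ n` translates the sphere by `(h s₁ - h s₀) n`, and moving it on the sphere of radius `s ≠ 3 / 4`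
from `s n₀` to `s n₁` translates the sphere by `k s • (n₁ - n₀)`, where `h` is `radialShift`
and `k` is `sphericalShift`. A loop of the tracer through two radii `s`, `s'` and two directions `a`, `b` therefore
translates the sphere by `((k - h) s - (k - h) s') • (a - b)` (`isJoinable_loop`), and `k - h` is
not locally constant. Since the differences of unit vectors fill a ball, the loops realize all
translations, and any two states on the same side of `s = 3 / 2` can be joined
(`isJoinable_of_norm_mem`). A connected set of states avoiding `s = 3 / 2` lies on one side.
-/

noncomputable section

open scoped ContDiff

/-! ### Derivatives of the Stokeslet and brackets of order two -/

section DirectionalDerivatives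

variable {E F : Type*} [NormedAddCommGroup E] [NormedSpace ℝ E] [NormedAddCommGroup F]
  [NormedSpace ℝ F]

theorem DifferentiableAt.fderiv_apply_eq_of_hasDerivAt_line {W : E → F} {x v : E} {w : F}
    (hW : DifferentiableAt ℝ W x) (h : HasDerivAt (fun t : ℝ => W (x + t • v)) w 0) :
    fderiv ℝ W x v = w := by
  have h1 : HasDerivAt (fun t : ℝ => x + t • v) v 0 := by
    simpa using ((hasDerivAt_id (0 : ℝ)).smul_const v).const_add x
  have h2 : HasFDerivAt W (fderiv ℝ W x) (x + (0 : ℝ) • v) := by simpa using hW.hasFDerivAt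
  exact (h2.comp_hasDerivAt (0 : ℝ) h1).unique h

theorem fderiv_apply_eq_of_eventuallyEq_line {W W' : E → F} {x v : E} {w : F}
    (hW : DifferentiableAt ℝ W x) (hWW' : W =ᶠ[𝓝 x] W')
    (h : HasDerivAt (fun t : ℝ => W' (x + t • v)) w 0) :
    fderiv ℝ W x v = w := by
  rw [hWW'.fderiv_eq]
  exact (hW.congr_of_eventuallyEq hWW'.symm).fderiv_apply_eq_of_hasDerivAt_line h

end DirectionalDerivatives

theorem hasDerivAt_norm_line {r : E3} (hr : r ≠ 0) (v : E3) :
    HasDerivAt (fun t : ℝ => ‖r + t • v‖) (inner ℝ r v / ‖r‖) 0 := by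
  have h1 : HasDerivAt (fun t : ℝ => r + t • v) v 0 := by
    simpa using ((hasDerivAt_id (0 : ℝ)).smul_const v).const_add r
  have h2 := h1.norm_sq.sqrt (by simpa using hr)
  have hr' : ‖r‖ ≠ 0 := norm_ne_zero_iff.2 hr
  simp only [Real.sqrt_sq (norm_nonneg _), zero_smul, add_zero] at h2
  convert h2 using 1
  field_simp

theorem hasDerivAt_inner_line (r v f : E3) :
    HasDerivAt (fun t : ℝ => inner ℝ (r + t • v) f) (inner ℝ v f) 0 := by
  have h1 : HasDerivAt (fun t : ℝ => r + t • v) v 0 := by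
    simpa using ((hasDerivAt_id (0 : ℝ)).smul_const v).const_add r
  simpa using h1.inner ℝ (hasDerivAt_const (0 : ℝ) f)

/-- The derivative of `r ↦ stokeslet r f` in the direction `v`. -/
def stokesletDeriv (r f v : E3) : E3 :=
  (3 / 4 : ℝ) • (-(inner ℝ r v / ‖r‖ ^ 3) • f
    + (inner ℝ v f / ‖r‖ ^ 3 - 3 * inner ℝ r f * inner ℝ r v / ‖r‖ ^ 5) • r
    + (inner ℝ r f / ‖r‖ ^ 3) • v)

theorem hasDerivAt_stokeslet_line {r : E3} (hr : r ≠ 0) (f v : E3) :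
    HasDerivAt (fun t : ℝ => stokeslet (r + t • v) f) (stokesletDeriv r f v) 0 := by
  have h1 : HasDerivAt (fun t : ℝ => r + t • v) v 0 := by
    simpa using ((hasDerivAt_id (0 : ℝ)).smul_const v).const_add r
  have hr' : ‖r‖ ≠ 0 := norm_ne_zero_iff.2 hr
  have hn := hasDerivAt_norm_line hr v
  have hi := hasDerivAt_inner_line r v f
  have h2 := ((((hasDerivAt_const (0 : ℝ) (1 : ℝ)).div hn (by simpa using hr')).smul_const f).add
    ((hi.div (hn.pow 3) (by simpa using hr')).smul h1)).const_smul (3 / 4 : ℝ)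
  refine h2.congr_deriv ?_
  simp only [stokesletDeriv, zero_smul, add_zero, Pi.div_apply, Pi.pow_apply]
  match_scalars <;> field_simp <;> ring

theorem contDiffAt_stokeslet (f : E3) {r : E3} (hr : r ≠ 0) :
    ContDiffAt ℝ ∞ (fun r => stokeslet r f) r := by
  have hr' : ‖r‖ ≠ 0 := norm_ne_zero_iff.2 hr
  have hn : ContDiffAt ℝ ∞ (fun r : E3 => ‖r‖) r := contDiffAt_norm ℝ hr
  have hi : ContDiffAt ℝ ∞ (fun r : E3 => inner ℝ r f) r := contDiffAt_id.inner ℝ contDiffAt_const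
  unfold stokeslet
  exact ((((contDiffAt_const (c := (1 : ℝ))).div hn hr').smul contDiffAt_const).add
    ((hi.div (hn.pow 3) (pow_ne_zero 3 hr')).smul contDiffAt_id)).const_smul (3 / 4 : ℝ)

theorem contDiffAt_tracerField (i : Fin 3) {X : TracerState} (hX : X.1 ≠ 0) :
    ContDiffAt ℝ ∞ (tracerField i) X := by
  have h : ContDiffAt ℝ ∞ (fun X : TracerState => stokeslet X.1 (EuclideanSpace.single i 1)) X :=
    (contDiffAt_stokeslet (EuclideanSpace.single i 1) hX).comp X contDiffAt_fst
  exact (h.sub contDiffAt_const).prodMk contDiffAt_const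

theorem eventually_fst_ne_zero {X : TracerState} (hX : X.1 ≠ 0) : ∀ᶠ Y in 𝓝 X, Y.1 ≠ 0 :=
  continuousAt_fst.eventually_ne hX

theorem IsIteratedBracket.contDiffAt {p : ℕ} {V : TracerState → TracerState}
    (h : IsIteratedBracket tracerField p V) {X : TracerState} (hX : X.1 ≠ 0) :
    ContDiffAt ℝ ∞ V X := by
  induction h with
  | field i => exact contDiffAt_tracerField i hX
  | bracket _ _ ihV ihW => exact ihV.lieBracket_vectorField ihW (by simp)

theorem IsIteratedBracket.differentiableAt {p : ℕ} {V : TracerState → TracerState}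
    (h : IsIteratedBracket tracerField p V) {X : TracerState} (hX : X.1 ≠ 0) :
    DifferentiableAt ℝ V X :=
  (h.contDiffAt hX).differentiableAt (by simp)

theorem snd_lieBracket {V W : TracerState → TracerState} {X : TracerState} {c d : E3}
    (hV : DifferentiableAt ℝ V X) (hW : DifferentiableAt ℝ W X)
    (hc : ∀ᶠ Y in 𝓝 X, (V Y).2 = c) (hd : ∀ᶠ Y in 𝓝 X, (W Y).2 = d) :
    (VectorField.lieBracket ℝ V W X).2 = 0 := by
  have h : ∀ {V : TracerState → TracerState} {c : E3} (_ : DifferentiableAt ℝ V X)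
      (_ : ∀ᶠ Y in 𝓝 X, (V Y).2 = c) (v : TracerState), (fderiv ℝ V X v).2 = 0 := by
    intro V c hV hc v
    have h1 := hV.hasFDerivAt.snd
    have h2 := h1.unique ((hasFDerivAt_const c X).congr_of_eventuallyEq hc)
    simpa using congrArg (fun L => L v) h2
  simp [VectorField.lieBracket, h hV hc, h hW hd]

/-- The sphere components of the control fields are constant, so the sphere component of a bracket
of order at least two vanishes. -/
theorem IsIteratedBracket.snd_eq {p : ℕ} {V : TracerState → TracerState}
    (h : IsIteratedBracket tracerField p V) :
    ∃ c : E3, (∀ X : TracerState, X.1 ≠ 0 → (V X).2 = c) ∧ (2 ≤ p → c = 0) := by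
  induction h with
  | field i => exact ⟨EuclideanSpace.single i 1, fun _ _ => rfl, by omega⟩
  | bracket hV hW ihV ihW =>
    obtain ⟨c, hc, -⟩ := ihV
    obtain ⟨d, hd, -⟩ := ihW
    refine ⟨0, fun X hX => snd_lieBracket (hV.differentiableAt hX) (hW.differentiableAt hX)
      ((eventually_fst_ne_zero hX).mono hc) ((eventually_fst_ne_zero hX).mono hd), fun _ => rfl⟩

theorem IsIteratedBracket.snd_eq_zero {p : ℕ} {V : TracerState → TracerState}
    (h : IsIteratedBracket tracerField p V) (hp : 2 ≤ p) {X : TracerState} (hX : X.1 ≠ 0) :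
    (V X).2 = 0 := by
  obtain ⟨c, hc, h0⟩ := h.snd_eq
  rw [hc X hX, h0 hp]

/-- The radial part `⟪r, v⟫` of a field `V = (v, w)`; it is not divided by `‖r‖`. -/
def radialPart (V : TracerState → TracerState) (X : TracerState) : ℝ := inner ℝ X.1 (V X).1

theorem hasFDerivAt_radialPart {V : TracerState → TracerState} {X : TracerState}
    (hV : DifferentiableAt ℝ V X) :
    HasFDerivAt (radialPart V) ((fderivInnerCLM ℝ (X.1, (V X).1)).comp
      ((ContinuousLinearMap.fst ℝ E3 E3).prod
        ((ContinuousLinearMap.fst ℝ E3 E3).comp (fderiv ℝ V X)))) X :=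
  hasFDerivAt_fst.inner ℝ hV.hasFDerivAt.fst

theorem differentiableAt_radialPart {V : TracerState → TracerState} {X : TracerState}
    (hV : DifferentiableAt ℝ V X) : DifferentiableAt ℝ (radialPart V) X :=
  (hasFDerivAt_radialPart hV).differentiableAt

theorem fderiv_radialPart {V : TracerState → TracerState} {X : TracerState}
    (hV : DifferentiableAt ℝ V X) (v : TracerState) :
    fderiv ℝ (radialPart V) X v = inner ℝ v.1 (V X).1 + inner ℝ X.1 (fderiv ℝ V X v).1 := by
  rw [(hasFDerivAt_radialPart hV).fderiv]
  simp [add_comm]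

/-- The radial part of a field is the derivative of `‖r‖² / 2` along it, so this is the usual
formula for the derivative of a function along a bracket. -/
theorem radialPart_lieBracket {V W : TracerState → TracerState} {X : TracerState}
    (hV : DifferentiableAt ℝ V X) (hW : DifferentiableAt ℝ W X) :
    radialPart (VectorField.lieBracket ℝ V W) X =
      fderiv ℝ (radialPart W) X (V X) - fderiv ℝ (radialPart V) X (W X) := by
  rw [fderiv_radialPart hV, fderiv_radialPart hW, real_inner_comm (V X).1]
  simp [radialPart, VectorField.lieBracket, inner_sub_right]

theorem inner_stokeslet_sub {r : E3} (hr : r ≠ 0) (f : E3) :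
    inner ℝ r (stokeslet r f - f) = (3 / (2 * ‖r‖) - 1) * inner ℝ r f := by
  have hr' : ‖r‖ ≠ 0 := norm_ne_zero_iff.2 hr
  simp only [stokeslet, inner_sub_right, inner_smul_right, inner_add_right,
    real_inner_self_eq_norm_sq]
  field_simp
  ring

theorem inner_single (r : E3) (i : Fin 3) : inner ℝ r (EuclideanSpace.single i (1 : ℝ)) = r i := by
  simp [EuclideanSpace.inner_single_right]

theorem radialPart_tracerField (i : Fin 3) {X : TracerState} (hX : X.1 ≠ 0) :
    radialPart (tracerField i) X = (3 / (2 * ‖X.1‖) - 1) * X.1 i := by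
  simp only [radialPart, tracerField]
  rw [inner_stokeslet_sub hX, inner_single]

/-- The coefficient of the rotation fields in the brackets of order two. -/
def rotCoeff (s : ℝ) : ℝ := 3 / (4 * s ^ 3) * (9 / (4 * s) - 2)

/-- The generator `r ↦ r_j e_i - r_i e_j` of the rotations in the plane of the axes `i`, `j`. -/
def rotGen (i j : Fin 3) (r : E3) : E3 :=
  r j • EuclideanSpace.single i (1 : ℝ) - r i • EuclideanSpace.single j (1 : ℝ)

theorem stokesletDeriv_antisymm {r : E3} (hr : r ≠ 0) (f g : E3) :
    stokesletDeriv r g (stokeslet r f - f) - stokesletDeriv r f (stokeslet r g - g) =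
      rotCoeff ‖r‖ • (inner ℝ r g • f - inner ℝ r f • g) := by
  have hr' : ‖r‖ ≠ 0 := norm_ne_zero_iff.2 hr
  rw [stokesletDeriv, stokesletDeriv, inner_stokeslet_sub hr, inner_stokeslet_sub hr]
  simp only [stokeslet, inner_sub_left, inner_smul_left, inner_add_left, rotCoeff,
    real_inner_comm f g, map_div₀, map_one, map_ofNat, conj_trivial]
  match_scalars <;> field_simp <;> ring

theorem fderiv_tracerField (i : Fin 3) {X : TracerState} (hX : X.1 ≠ 0) (v : TracerState) :
    fderiv ℝ (tracerField i) X v =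
      (stokesletDeriv X.1 (EuclideanSpace.single i 1) v.1, 0) := by
  refine ((contDiffAt_tracerField i hX).differentiableAt
    (by simp)).fderiv_apply_eq_of_hasDerivAt_line ?_
  exact ((hasDerivAt_stokeslet_line hX _ v.1).sub_const _).prodMk (hasDerivAt_const _ _)

theorem gBr_eq (i j : Fin 3) {X : TracerState} (hX : X.1 ≠ 0) :
    gBr i j X = (rotCoeff ‖X.1‖ • rotGen i j X.1, 0) := by
  have h := stokesletDeriv_antisymm hX (EuclideanSpace.single i 1) (EuclideanSpace.single j 1)
  rw [inner_single, inner_single] at h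
  simp only [gBr, VectorField.lieBracket, fderiv_tracerField _ hX]
  exact Prod.ext h (by simp)

/-! ### Radial parts of the brackets and their spans -/

theorem isIteratedBracket_gBr (i j : Fin 3) : IsIteratedBracket tracerField 2 (gBr i j) :=
  .bracket (.field i) (.field j)

theorem isIteratedBracket_gBr₃ (i j k : Fin 3) : IsIteratedBracket tracerField 3 (gBr₃ i j k) :=
  .bracket (.field i) (isIteratedBracket_gBr j k)

theorem isIteratedBracket_gBr₄ (i j k l : Fin 3) :
    IsIteratedBracket tracerField 4 (gBr₄ i j k l) :=
  .bracket (.field i) (isIteratedBracket_gBr₃ j k l)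

theorem inner_rotGen (i j : Fin 3) (r : E3) : inner ℝ r (rotGen i j r) = 0 := by
  simp only [rotGen, inner_sub_right, inner_smul_right, inner_single]
  ring

theorem radialPart_gBr (i j : Fin 3) {X : TracerState} (hX : X.1 ≠ 0) :
    radialPart (gBr i j) X = 0 := by
  simp [radialPart, gBr_eq i j hX, inner_smul_right, inner_rotGen]

/-- The mobility `3 / (2 s) - 1` of the relative position in the radial direction, at distance
`s`: it vanishes at `s = 3 / 2`. -/
def radialMobility (s : ℝ) : ℝ := 3 / (2 * s) - 1

theorem fderiv_radialPart_tracerField (i : Fin 3) {X v : TracerState} (hX : X.1 ≠ 0)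
    (hv : inner ℝ X.1 v.1 = 0) :
    fderiv ℝ (radialPart (tracerField i)) X v = radialMobility ‖X.1‖ * v.1 i := by
  have hX' : ‖X.1‖ ≠ 0 := norm_ne_zero_iff.2 hX
  refine fderiv_apply_eq_of_eventuallyEq_line
    (differentiableAt_radialPart ((contDiffAt_tracerField i hX).differentiableAt (by simp)))
    (W' := fun X => (3 / (2 * ‖X.1‖) - 1) * inner ℝ X.1 (EuclideanSpace.single i 1)) ?_ ?_
  · filter_upwards [eventually_fst_ne_zero hX] with Y hY
    rw [radialPart_tracerField i hY, inner_single]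
  · have hn := hasDerivAt_norm_line hX v.1
    rw [hv, zero_div] at hn
    have h := (((hasDerivAt_const (0 : ℝ) (3 : ℝ)).div (hn.const_mul 2)
      (by simpa using hX')).sub_const 1).mul
      (hasDerivAt_inner_line X.1 v.1 (EuclideanSpace.single i 1))
    refine h.congr_deriv ?_
    simp [radialMobility, inner_single]

theorem radialPart_gBr₃ (k i j : Fin 3) {X : TracerState} (hX : X.1 ≠ 0) :
    radialPart (gBr₃ k i j) X =
      -(radialMobility ‖X.1‖ * (rotCoeff ‖X.1‖ * rotGen i j X.1 k)) := by
  have h0 : radialPart (gBr i j) =ᶠ[𝓝 X] fun _ => 0 := by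
    filter_upwards [eventually_fst_ne_zero hX] with Y hY using radialPart_gBr i j hY
  rw [gBr₃, radialPart_lieBracket ((IsIteratedBracket.field k).differentiableAt hX)
    ((isIteratedBracket_gBr i j).differentiableAt hX), h0.fderiv_eq,
    fderiv_radialPart_tracerField k hX (by
      simp [gBr_eq i j hX, inner_smul_right, inner_rotGen])]
  simp [gBr_eq i j hX]

theorem rotCoeff_nine_eighths : rotCoeff (9 / 8) = 0 := by norm_num [rotCoeff]

theorem hasDerivAt_rotCoeff : HasDerivAt rotCoeff (-(3 / (2 * (9 / 8) ^ 4))) (9 / 8) := by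
  have h1 := (hasDerivAt_id (9 / 8 : ℝ))
  have h := ((hasDerivAt_const (9 / 8 : ℝ) (3 : ℝ)).div ((h1.pow 3).const_mul 4)
    (by norm_num)).mul (((hasDerivAt_const (9 / 8 : ℝ) (9 : ℝ)).div (h1.const_mul 4)
    (by norm_num)).sub_const 2)
  refine h.congr_deriv ?_
  norm_num

theorem hasDerivAt_rotGen_line (i j : Fin 3) (r v : E3) :
    HasDerivAt (fun t : ℝ => rotGen i j (r + t • v)) (rotGen i j v) 0 := by
  have h : ∀ i : Fin 3, HasDerivAt (fun t : ℝ => (r + t • v) i) (v i) 0 := fun i => by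
    simpa [inner_single] using hasDerivAt_inner_line r v (EuclideanSpace.single i 1)
  exact ((h j).smul_const _).sub ((h i).smul_const _)

/-- The factor `1 / 3` is the value of `radialMobility` at `9 / 8`. -/
theorem inner_tracerField_of_norm_eq (k : Fin 3) {X : TracerState} (hX : ‖X.1‖ = 9 / 8) :
    inner ℝ X.1 (tracerField k X).1 = X.1 k / 3 := by
  have h := radialPart_tracerField k (X := X) (by intro h; norm_num [h] at hX)
  rw [hX] at h
  rw [← radialPart, h]
  ring

theorem hasDerivAt_rotCoeff_line {r : E3} (hr : ‖r‖ = 9 / 8) (v : E3) :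
    HasDerivAt (fun t : ℝ => rotCoeff ‖r + t • v‖)
      (-(3 / (2 * (9 / 8) ^ 4)) * (inner ℝ r v / (9 / 8))) 0 := by
  have hn := hasDerivAt_norm_line (r := r) (by rintro rfl; norm_num at hr) v
  rw [hr] at hn
  exact HasDerivAt.comp (0 : ℝ) (by simpa [hr] using hasDerivAt_rotCoeff) hn

/-- At distance `9 / 8` the brackets of order two vanish, and those of order three only see the
derivative of their coefficient. -/
theorem gBr₃_eq (k i j : Fin 3) {X : TracerState} (hX : ‖X.1‖ = 9 / 8) :
    gBr₃ k i j X = ((-(3 / (2 * (9 / 8) ^ 4)) * (X.1 k / 3 / (9 / 8))) • rotGen i j X.1, 0) := by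
  have hX0 : X.1 ≠ 0 := by intro h; norm_num [h] at hX
  have hz : gBr i j X = 0 := by simp [gBr_eq i j hX0, hX, rotCoeff_nine_eighths]
  simp only [gBr₃, VectorField.lieBracket]
  rw [hz, map_zero, sub_zero]
  refine fderiv_apply_eq_of_eventuallyEq_line
    ((isIteratedBracket_gBr i j).differentiableAt hX0)
    (W' := fun X => (rotCoeff ‖X.1‖ • rotGen i j X.1, 0)) ?_ ?_
  · filter_upwards [eventually_fst_ne_zero hX0] with Y hY using gBr_eq i j hY
  · have h := ((hasDerivAt_rotCoeff_line hX (tracerField k X).1).smul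
      (hasDerivAt_rotGen_line i j X.1 (tracerField k X).1)).prodMk
      (hasDerivAt_const (0 : ℝ) (0 : E3))
    refine h.congr_deriv ?_
    have hr := inner_tracerField_of_norm_eq k hX
    simp only [hr, zero_smul, add_zero, hX, rotCoeff_nine_eighths, zero_add]

/-- Since `rotCoeff` vanishes at `9 / 8`, only the terms containing its derivative
`-(3 / (2 * (9 / 8) ^ 4))` there remain. -/
theorem radialPart_gBr₄ (l k i j : Fin 3) {X : TracerState} (hX : ‖X.1‖ = 9 / 8) :
    radialPart (gBr₄ l k i j) X =
      3 / (2 * (9 / 8) ^ 4) / (9 / 8) / 9 *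
        (X.1 l * rotGen i j X.1 k + X.1 k * rotGen i j X.1 l) := by
  have hX0 : X.1 ≠ 0 := by intro h; norm_num [h] at hX
  have hr := inner_tracerField_of_norm_eq l hX
  have hd : fderiv ℝ (radialPart (gBr₃ k i j)) X (tracerField l X) =
      -(1 / 3 * (-(3 / (2 * (9 / 8) ^ 4)) * (X.1 l / 3 / (9 / 8)) * rotGen i j X.1 k)) := by
    refine fderiv_apply_eq_of_eventuallyEq_line
      (differentiableAt_radialPart ((isIteratedBracket_gBr₃ k i j).differentiableAt hX0))
      (W' := fun X => -((3 / (2 * ‖X.1‖) - 1) *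
        (rotCoeff ‖X.1‖ * inner ℝ (rotGen i j X.1) (EuclideanSpace.single k 1)))) ?_ ?_
    · filter_upwards [eventually_fst_ne_zero hX0] with Y hY
      rw [radialPart_gBr₃ k i j hY, inner_single, radialMobility]
    · set v := (tracerField l X).1
      have hm := ((hasDerivAt_const (0 : ℝ) (3 : ℝ)).div
        ((hasDerivAt_norm_line hX0 v).const_mul 2) (by simp [hX0])).sub_const 1
      have h := (hm.mul ((hasDerivAt_rotCoeff_line hX v).mul
        ((hasDerivAt_rotGen_line i j X.1 v).inner ℝ
          (hasDerivAt_const (0 : ℝ) (EuclideanSpace.single k (1 : ℝ)))))).neg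
      refine h.congr_deriv ?_
      simp only [Pi.div_apply, Pi.mul_apply, zero_smul, add_zero, hX, rotCoeff_nine_eighths, hr,
        inner_single]
      norm_num
  rw [gBr₄, radialPart_lieBracket ((IsIteratedBracket.field l).differentiableAt hX0)
    ((isIteratedBracket_gBr₃ k i j).differentiableAt hX0), hd,
    fderiv_radialPart_tracerField l hX0 (by
      simp [gBr₃_eq k i j hX, inner_smul_right, inner_rotGen]), gBr₃_eq k i j hX, hX,
    radialMobility]
  simp only [PiLp.smul_apply, smul_eq_mul]
  ring

/-- The derivative, along a tangent vector, of a function that vanishes on the sphere of radius `R`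
in the tracer variable is zero. -/
theorem fderiv_eq_zero_of_vanishing_on_sphere {ψ : TracerState → ℝ} {X v : TracerState}
    (hψ : DifferentiableAt ℝ ψ X) {R : ℝ} (hR : 0 < R) (hX : ‖X.1‖ = R)
    (h0 : ∀ Y : TracerState, ‖Y.1‖ = R → ψ Y = 0) (hv : inner ℝ X.1 v.1 = 0) :
    fderiv ℝ ψ X v = 0 := by
  have hX0 : X.1 ≠ 0 := by intro h; simp [h] at hX; exact hR.ne hX
  have hX' : ‖X.1‖ ≠ 0 := norm_ne_zero_iff.2 hX0
  have h1 : HasDerivAt (fun t : ℝ => X.1 + t • v.1) v.1 0 := by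
    simpa using ((hasDerivAt_id (0 : ℝ)).smul_const v.1).const_add X.1
  have h2 : HasDerivAt (fun t : ℝ => X.2 + t • v.2) v.2 0 := by
    simpa using ((hasDerivAt_id (0 : ℝ)).smul_const v.2).const_add X.2
  have hn := hasDerivAt_norm_line hX0 v.1
  rw [hv, zero_div] at hn
  -- the straight line through `X` in the direction `v`, its tracer part projected to the sphere
  have hγ : HasDerivAt (fun t : ℝ => ((R / ‖X.1 + t • v.1‖) • (X.1 + t • v.1), X.2 + t • v.2))
      v 0 := by
    refine ((((hasDerivAt_const (0 : ℝ) R).div hn (by simpa using hX')).smul h1).prodMk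
      h2).congr_deriv ?_
    simp [hX, hR.ne']
  have hψ' : HasFDerivAt ψ (fderiv ℝ ψ X)
      ((R / ‖X.1 + (0 : ℝ) • v.1‖) • (X.1 + (0 : ℝ) • v.1), X.2 + (0 : ℝ) • v.2) := by
    simpa [hX, hR.ne'] using hψ.hasFDerivAt
  refine (hψ'.comp_hasDerivAt (0 : ℝ) hγ).unique
    ((hasDerivAt_const (0 : ℝ) (0 : ℝ)).congr_of_eventuallyEq ?_)
  filter_upwards [h1.continuousAt.eventually_ne (by simpa using hX0)] with t ht
  refine h0 _ ?_
  rw [norm_smul, norm_div, norm_norm, Real.norm_of_nonneg hR.le,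
    div_mul_cancel₀ _ (norm_ne_zero_iff.2 ht)]

/-- All iterated brackets are tangent to the sphere of radius `3 / 2`. -/
theorem IsIteratedBracket.radialPart_eq_zero {p : ℕ} {V : TracerState → TracerState}
    (h : IsIteratedBracket tracerField p V) {X : TracerState} (hX : ‖X.1‖ = 3 / 2) :
    radialPart V X = 0 := by
  induction h generalizing X with
  | field i =>
    rw [radialPart_tracerField i (by intro h; norm_num [h] at hX), hX]
    norm_num
  | bracket hV hW ihV ihW =>
    have hX0 : X.1 ≠ 0 := by intro h; norm_num [h] at hX
    rw [radialPart_lieBracket (hV.differentiableAt hX0) (hW.differentiableAt hX0),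
      fderiv_eq_zero_of_vanishing_on_sphere
        (differentiableAt_radialPart (hW.differentiableAt hX0)) (by norm_num) hX
        (fun _ => ihW) (ihV hX),
      fderiv_eq_zero_of_vanishing_on_sphere
        (differentiableAt_radialPart (hV.differentiableAt hX0)) (by norm_num) hX
        (fun _ => ihV) (ihW hX), sub_zero]

section LowOrder

variable {ι E : Type*} [NormedAddCommGroup E] [NormedSpace ℝ E] {g : ι → E → E}
  {V : E → E} {p : ℕ}

theorem IsIteratedBracket.one_le (h : IsIteratedBracket g p V) : 1 ≤ p := by
  induction h with
  | field i => exact le_rfl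
  | bracket _ _ ihV _ => omega

theorem IsIteratedBracket.exists_of_order_one (h : IsIteratedBracket g p V) (hp : p = 1) :
    ∃ i, V = g i := by
  cases h with
  | field i => exact ⟨i, rfl⟩
  | bracket hV hW => have := hV.one_le; have := hW.one_le; omega

theorem IsIteratedBracket.exists_of_order_two (h : IsIteratedBracket g p V) (hp : p = 2) :
    ∃ i j, V = VectorField.lieBracket ℝ (g i) (g j) := by
  cases h with
  | field i => omega
  | bracket hV hW =>
    have := hV.one_le
    have := hW.one_le
    obtain ⟨i, rfl⟩ := hV.exists_of_order_one (by omega)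
    obtain ⟨j, rfl⟩ := hW.exists_of_order_one (by omega)
    exact ⟨i, j, rfl⟩

/-- By antisymmetry the brackets `[g_k, [g_i, g_j]]` are all those of order three, up to sign. -/
theorem IsIteratedBracket.exists_of_order_three (h : IsIteratedBracket g p V) (hp : p = 3) :
    ∃ k i j, V = VectorField.lieBracket ℝ (g k) (VectorField.lieBracket ℝ (g i) (g j)) ∨
      V = -VectorField.lieBracket ℝ (g k) (VectorField.lieBracket ℝ (g i) (g j)) := by
  cases h with
  | field i => omega
  | @bracket p q _ _ hV hW =>
    have := hV.one_le
    have := hW.one_le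
    obtain hp1 | hp2 : p = 1 ∨ p = 2 := by omega
    · obtain ⟨k, rfl⟩ := hV.exists_of_order_one hp1
      obtain ⟨i, j, rfl⟩ := hW.exists_of_order_two (by omega)
      exact ⟨k, i, j, .inl rfl⟩
    · obtain ⟨i, j, rfl⟩ := hV.exists_of_order_two hp2
      obtain ⟨k, rfl⟩ := hW.exists_of_order_one (by omega)
      exact ⟨k, i, j, .inr (funext fun x => VectorField.lieBracket_swap)⟩

theorem bracketSpanUpTo_mono (g : ι → E → E) (X : E) {p q : ℕ} (hpq : p ≤ q) :
    bracketSpanUpTo g p X ≤ bracketSpanUpTo g q X :=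
  Submodule.span_mono fun _ ⟨n, hn, V, hV, hv⟩ => ⟨n, hn.trans hpq, V, hV, hv⟩

theorem bracketSpanUpTo_le_bracketSpan (g : ι → E → E) (p : ℕ) (X : E) :
    bracketSpanUpTo g p X ≤ bracketSpan g X :=
  Submodule.span_mono fun _ ⟨n, _, V, hV, hv⟩ => ⟨n, V, hV, hv⟩

theorem IsIteratedBracket.mem_bracketSpanUpTo (h : IsIteratedBracket g p V) {q : ℕ} (hpq : p ≤ q)
    (X : E) : V X ∈ bracketSpanUpTo g q X :=
  Submodule.subset_span ⟨p, hpq, V, h, rfl⟩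

end LowOrder

/-- Vectors annihilated by the covector `(u, v) ↦ ⟪r, u⟫ - μ ⟪r, v⟫` do not span. -/
theorem span_ne_top_of_inner_eq {S : Set TracerState} {r : E3} (hr : r ≠ 0) (μ : ℝ)
    (h : ∀ v ∈ S, inner ℝ r v.1 = μ * inner ℝ r v.2) : Submodule.span ℝ S ≠ ⊤ := by
  intro htop
  have hmem : ((r, 0) : TracerState) ∈ Submodule.span ℝ S := htop ▸ Submodule.mem_top
  have key : ∀ v ∈ Submodule.span ℝ S, inner ℝ r v.1 = μ * inner ℝ r v.2 := fun v hv => by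
    induction hv using Submodule.span_induction with
    | mem v hv => exact h v hv
    | zero => simp
    | add v w _ _ hv hw => simp only [Prod.fst_add, Prod.snd_add, inner_add_right, hv, hw]; ring
    | smul c v _ hv => simp only [Prod.smul_fst, Prod.smul_snd, inner_smul_right, hv]; ring
  have := key _ hmem
  simp only [inner_zero_right, mul_zero, inner_self_eq_zero] at this
  exact hr this

theorem bracketSpan_ne_top {X : TracerState} (hX : ‖X.1‖ = 3 / 2) :
    bracketSpan tracerField X ≠ ⊤ := by
  refine span_ne_top_of_inner_eq (r := X.1) (by intro h; norm_num [h] at hX) 0 ?_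
  rintro _ ⟨q, V, hV, rfl⟩
  simpa [radialPart] using hV.radialPart_eq_zero hX

theorem bracketSpanUpTo_three_ne_top {X : TracerState} (hX : ‖X.1‖ = 9 / 8) :
    bracketSpanUpTo tracerField 3 X ≠ ⊤ := by
  have hX0 : X.1 ≠ 0 := by intro h; norm_num [h] at hX
  refine span_ne_top_of_inner_eq hX0 (radialMobility ‖X.1‖) ?_
  rintro _ ⟨q, hq, V, hV, rfl⟩
  have hq1 := hV.one_le
  interval_cases q
  · obtain ⟨i, rfl⟩ := hV.exists_of_order_one rfl
    have := radialPart_tracerField i hX0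
    rw [radialPart] at this
    rw [this, radialMobility, tracerField, inner_single]
  · rw [hV.snd_eq_zero le_rfl hX0, inner_zero_right, mul_zero]
    obtain ⟨i, j, rfl⟩ := hV.exists_of_order_two rfl
    exact radialPart_gBr i j hX0
  · rw [hV.snd_eq_zero (by norm_num) hX0, inner_zero_right, mul_zero]
    have h0 : ∀ k i j, radialPart (gBr₃ k i j) X = 0 := fun k i j => by
      rw [radialPart_gBr₃ k i j hX0, hX, rotCoeff_nine_eighths]
      simp
    obtain ⟨k, i, j, rfl | rfl⟩ := hV.exists_of_order_three rfl
    · exact h0 k i j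
    · have := h0 k i j
      simp only [radialPart] at this
      simpa using! this

/-- The rotation directions span the plane orthogonal to `r`; with one vector `w` that has a radial
component they give all `(u, 0)`, and the control fields then give all `(0, v)`. -/
theorem eq_top_of_perp_of_radial {W : Submodule ℝ TracerState} {X : TracerState}
    (hg : ∀ i, tracerField i X ∈ W)
    (hperp : ∀ i j, ((rotGen i j X.1, 0) : TracerState) ∈ W)
    {w : TracerState} (hw : w ∈ W) (hw2 : w.2 = 0) (hrw : inner ℝ X.1 w.1 ≠ 0) : W = ⊤ := by
  have hX0 : X.1 ≠ 0 := by rintro h; simp [h] at hrw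
  have hperp' : ∀ u : E3, inner ℝ X.1 u = 0 → ((u, 0) : TracerState) ∈ W := fun u hu => by
    have h : (‖X.1‖ ^ 2) • ((u, 0) : TracerState) =
        ∑ i, ∑ j, (u i * X.1 j) • ((rotGen i j X.1, 0) : TracerState) := by
      have hn : ‖X.1‖ ^ 2 = X.1 0 ^ 2 + X.1 1 ^ 2 + X.1 2 ^ 2 := by
        simp [EuclideanSpace.norm_sq_eq, Fin.sum_univ_three]
      have hu' : X.1 0 * u 0 + X.1 1 * u 1 + X.1 2 * u 2 = 0 := by
        rw [← hu]; simp [PiLp.inner_apply, Fin.sum_univ_three, mul_comm]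
      rw [hn]
      refine Prod.ext (PiLp.ext fun m => ?_) (by simp [Fin.sum_univ_three])
      fin_cases m <;> simp [Fin.sum_univ_three, rotGen]
      · linear_combination X.1 0 * hu'
      · linear_combination X.1 1 * hu'
      · linear_combination X.1 2 * hu'
    have h' : (‖X.1‖ ^ 2) • ((u, 0) : TracerState) ∈ W :=
      h ▸ W.sum_mem fun i _ => W.sum_mem fun j _ => W.smul_mem _ (hperp i j)
    exact (W.smul_mem_iff (pow_ne_zero 2 (norm_ne_zero_iff.2 hX0))).1 h'
  have hfst : ∀ u : E3, ((u, 0) : TracerState) ∈ W := fun u => by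
    have h1 := hperp' (u - (inner ℝ X.1 u / inner ℝ X.1 w.1) • w.1) (by
      rw [inner_sub_right, inner_smul_right]; field_simp; ring)
    have h2 := W.add_mem h1 (W.smul_mem (inner ℝ X.1 u / inner ℝ X.1 w.1) hw)
    convert h2 using 1
    ext <;> simp [hw2]
  have hsnd : ∀ i, ((0, EuclideanSpace.single i 1) : TracerState) ∈ W := fun i => by
    have h := W.sub_mem (hg i) (hfst (tracerField i X).1)
    convert h using 1
    simp [tracerField]
  refine eq_top_iff.2 fun Y _ => ?_
  have h : Y = (Y.1, 0) + ∑ i, Y.2 i • ((0, EuclideanSpace.single i 1) : TracerState) := by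
    refine Prod.ext (by simp [Fin.sum_univ_three]) (PiLp.ext fun m => ?_)
    fin_cases m <;> simp [Fin.sum_univ_three]
  rw [h]
  exact W.add_mem (hfst _) (W.sum_mem fun i _ => W.smul_mem _ (hsnd i))

theorem exists_coord_ne_zero {r : E3} (hr : r ≠ 0) : ∃ j, r j ≠ 0 := by
  by_contra! h
  exact hr (PiLp.ext h)

theorem rotCoeff_ne_zero {s : ℝ} (hs : 0 < s) (h : s ≠ 9 / 8) : rotCoeff s ≠ 0 := by
  refine mul_ne_zero (by positivity) fun h0 => h ?_
  field_simp at h0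
  linarith

theorem radialMobility_ne_zero {s : ℝ} (hs : 0 < s) (h : s ≠ 3 / 2) : radialMobility s ≠ 0 := by
  refine fun h0 => h ?_
  rw [radialMobility] at h0
  field_simp at h0
  linarith

theorem bracketSpanUpTo_three_eq_top {X : TracerState} (hX0 : X.1 ≠ 0) (h1 : ‖X.1‖ ≠ 3 / 2)
    (h2 : ‖X.1‖ ≠ 9 / 8) : bracketSpanUpTo tracerField 3 X = ⊤ := by
  have hpos := norm_pos_iff.2 hX0
  have hc := rotCoeff_ne_zero hpos h2
  obtain ⟨j, hj⟩ := exists_coord_ne_zero hX0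
  obtain ⟨i, hij⟩ : ∃ i : Fin 3, i ≠ j := exists_ne j
  refine eq_top_of_perp_of_radial
    (fun i => (IsIteratedBracket.field i).mem_bracketSpanUpTo (by norm_num) X)
    (fun i j => ?_)
    ((isIteratedBracket_gBr₃ i i j).mem_bracketSpanUpTo le_rfl X)
    ((isIteratedBracket_gBr₃ i i j).snd_eq_zero (by norm_num) hX0) ?_
  · have h := (isIteratedBracket_gBr i j).mem_bracketSpanUpTo (q := 3) (by norm_num) X
    rw [gBr_eq i j hX0] at h
    refine ((bracketSpanUpTo tracerField 3 X).smul_mem_iff hc).1 ?_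
    simpa using h
  · change radialPart _ X ≠ 0
    rw [radialPart_gBr₃ i i j hX0]
    refine neg_ne_zero.2 (mul_ne_zero (radialMobility_ne_zero hpos h1) (mul_ne_zero hc ?_))
    simpa [rotGen, hij] using hj

theorem bracketSpanUpTo_four_eq_top_of_nine_eighths {X : TracerState} (hX : ‖X.1‖ = 9 / 8) :
    bracketSpanUpTo tracerField 4 X = ⊤ := by
  have hX0 : X.1 ≠ 0 := by intro h; norm_num [h] at hX
  obtain ⟨j, hj⟩ := exists_coord_ne_zero hX0
  obtain ⟨i, hij⟩ : ∃ i : Fin 3, i ≠ j := exists_ne j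
  obtain ⟨l, k, hlk⟩ : ∃ l k, X.1 l * rotGen i j X.1 k + X.1 k * rotGen i j X.1 l ≠ 0 := by
    by_cases hi : X.1 i = 0
    -- the value of the expression is `X.1 j ^ 2 - X.1 i ^ 2` here and `2 * X.1 i * X.1 j` below
    · exact ⟨i, j, by simpa [rotGen, hij, hij.symm, hi] using hj⟩
    · exact ⟨i, i, by simpa [rotGen, hij, ← two_mul] using ⟨hi, hj⟩⟩
  refine eq_top_of_perp_of_radial
    (fun i => (IsIteratedBracket.field i).mem_bracketSpanUpTo (by norm_num) X)
    (fun m n => ?_)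
    ((isIteratedBracket_gBr₄ l k i j).mem_bracketSpanUpTo le_rfl X)
    ((isIteratedBracket_gBr₄ l k i j).snd_eq_zero (by norm_num) hX0) ?_
  · have h := (isIteratedBracket_gBr₃ j m n).mem_bracketSpanUpTo (q := 4) (by norm_num) X
    rw [gBr₃_eq j m n hX] at h
    refine ((bracketSpanUpTo tracerField 4 X).smul_mem_iff
      (s := -(3 / (2 * (9 / 8) ^ 4)) * (X.1 j / 3 / (9 / 8))) (by simpa using hj)).1 ?_
    simpa using h
  · change radialPart _ X ≠ 0
    rw [radialPart_gBr₄ l k i j hX]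
    exact mul_ne_zero (by norm_num) hlk

theorem bracketSpanUpTo_three_eq_top_iff {X : TracerState} (hX0 : X.1 ≠ 0) :
    bracketSpanUpTo tracerField 3 X = ⊤ ↔ ‖X.1‖ ≠ 3 / 2 ∧ ‖X.1‖ ≠ 9 / 8 := by
  refine ⟨fun h => ⟨fun h1 => bracketSpan_ne_top h1 ?_, fun h2 =>
    bracketSpanUpTo_three_ne_top h2 h⟩, fun h => bracketSpanUpTo_three_eq_top hX0 h.1 h.2⟩
  exact top_le_iff.1 (h ▸ bracketSpanUpTo_le_bracketSpan tracerField 3 X)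

theorem bracketSpanUpTo_four_eq_top_iff {X : TracerState} (hX0 : X.1 ≠ 0) :
    bracketSpanUpTo tracerField 4 X = ⊤ ↔ ‖X.1‖ ≠ 3 / 2 := by
  refine ⟨fun h h1 => bracketSpan_ne_top h1 ?_, fun h1 => ?_⟩
  · exact top_le_iff.1 (h ▸ bracketSpanUpTo_le_bracketSpan tracerField 4 X)
  · by_cases h2 : ‖X.1‖ = 9 / 8
    · exact bracketSpanUpTo_four_eq_top_of_nine_eighths h2
    · exact top_le_iff.1 (bracketSpanUpTo_three_eq_top hX0 h1 h2 ▸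
        bracketSpanUpTo_mono tracerField X (by norm_num))

theorem controllableStateSet_tracerField {ρ : ℝ} (hρ : 0 ≤ ρ) :
    controllableStateSet tracerField (tracerStates ρ) =
      {X ∈ tracerStates ρ | ‖X.1‖ ≠ 3 / 2} := by
  ext X
  refine and_congr_right fun hX => ?_
  have hX0 : X.1 ≠ 0 := norm_pos_iff.1 (hρ.trans_lt hX)
  constructor
  · exact fun h h1 => bracketSpan_ne_top h1 (Submodule.eq_top_of_finrank_eq h)
  · intro h1
    have : bracketSpan tracerField X = ⊤ := top_le_iff.1
      ((bracketSpanUpTo_four_eq_top_iff hX0).2 h1 ▸ bracketSpanUpTo_le_bracketSpan _ 4 X)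
    rw [this, finrank_top]

/-- At a configuration on the first axis, the generators of the rotations moving this axis give
all rotation directions. -/
theorem rotGen_mem_of_axis {W : Submodule ℝ TracerState} {d : ℝ}
    (h1 : ((rotGen 0 1 (EuclideanSpace.single 0 d), 0) : TracerState) ∈ W)
    (h2 : ((rotGen 0 2 (EuclideanSpace.single 0 d), 0) : TracerState) ∈ W) (i j : Fin 3) :
    ((rotGen i j (EuclideanSpace.single 0 d), 0) : TracerState) ∈ W := by
  have h1' := W.neg_mem h1
  have h2' := W.neg_mem h2
  fin_cases i <;> fin_cases j <;> simp [rotGen] at h1 h2 h1' h2' ⊢ <;>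
    first | assumption | exact W.zero_mem

theorem span_reduced_eq_top_iff {d : ℝ} (hd : 0 < d) {X : TracerState}
    (hX : X.1 = EuclideanSpace.single 0 d) :
    Submodule.span ℝ {tracerField 0 X, tracerField 1 X, tracerField 2 X,
      gBr 0 1 X, gBr 0 2 X, gBr₃ 1 0 1 X} = ⊤ ↔ d ≠ 3 / 2 ∧ d ≠ 9 / 8 := by
  have hn : ‖X.1‖ = d := by simp [hX, abs_of_pos hd]
  have hX0 : X.1 ≠ 0 := norm_pos_iff.1 (hn ▸ hd)
  constructor
  · intro h
    rw [← hn, ← bracketSpanUpTo_three_eq_top_iff hX0, ← top_le_iff, ← h, Submodule.span_le]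
    simp only [Set.insert_subset_iff, Set.singleton_subset_iff]
    have hfield := fun i => (IsIteratedBracket.field (g := tracerField) i).mem_bracketSpanUpTo
      (show 1 ≤ 3 by norm_num) X
    have hbr := fun i j => (isIteratedBracket_gBr i j).mem_bracketSpanUpTo
      (show 2 ≤ 3 by norm_num) X
    exact ⟨hfield 0, hfield 1, hfield 2, hbr 0 1, hbr 0 2,
      (isIteratedBracket_gBr₃ 1 0 1).mem_bracketSpanUpTo le_rfl X⟩
  · rintro ⟨h1, h2⟩
    have hc : rotCoeff ‖X.1‖ ≠ 0 := rotCoeff_ne_zero (hn ▸ hd) (hn ▸ h2)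
    set W := Submodule.span ℝ {tracerField 0 X, tracerField 1 X, tracerField 2 X,
      gBr 0 1 X, gBr 0 2 X, gBr₃ 1 0 1 X} with hW
    have hrot : ∀ i j, gBr i j X ∈ W → ((rotGen i j X.1, 0) : TracerState) ∈ W :=
      fun i j h => by
        rw [gBr_eq i j hX0] at h
        refine (W.smul_mem_iff hc).1 ?_
        simpa using h
    refine eq_top_of_perp_of_radial (X := X) (w := gBr₃ 1 0 1 X) (fun i => ?_) ?_
      (Submodule.subset_span (by simp))
      ((isIteratedBracket_gBr₃ 1 0 1).snd_eq_zero (by norm_num) hX0) ?_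
    · fin_cases i <;> exact Submodule.subset_span (by simp)
    · have h01 := hrot 0 1 (Submodule.subset_span (by simp))
      have h02 := hrot 0 2 (Submodule.subset_span (by simp))
      rw [hX] at h01 h02 ⊢
      exact rotGen_mem_of_axis h01 h02
    · change radialPart _ X ≠ 0
      rw [radialPart_gBr₃ 1 0 1 hX0]
      refine neg_ne_zero.2 (mul_ne_zero (radialMobility_ne_zero (hn ▸ hd) (hn ▸ h1))
        (mul_ne_zero hc ?_))
      simpa [rotGen, hX] using hd.ne'

theorem span_reduced_nine_eighths_eq_top {X : TracerState}
    (hX : X.1 = EuclideanSpace.single 0 (9 / 8)) {l k : Fin 3}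
    (hlk : X.1 l * rotGen 0 1 X.1 k + X.1 k * rotGen 0 1 X.1 l ≠ 0) :
    Submodule.span ℝ {tracerField 0 X, tracerField 1 X, tracerField 2 X,
      gBr₃ 0 0 1 X, gBr₃ 0 0 2 X, gBr₄ l k 0 1 X} = ⊤ := by
  have hn : ‖X.1‖ = 9 / 8 := by simp [hX]
  have hX0 : X.1 ≠ 0 := by intro h; norm_num [h] at hn
  set W := Submodule.span ℝ {tracerField 0 X, tracerField 1 X, tracerField 2 X,
    gBr₃ 0 0 1 X, gBr₃ 0 0 2 X, gBr₄ l k 0 1 X} with hW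
  have hrot : ∀ i j, gBr₃ 0 i j X ∈ W → ((rotGen i j X.1, 0) : TracerState) ∈ W :=
    fun i j h => by
      rw [gBr₃_eq 0 i j hn] at h
      refine (W.smul_mem_iff (s := -(3 / (2 * (9 / 8) ^ 4)) * (X.1 0 / 3 / (9 / 8)))
        (by simp [hX])).1 ?_
      simpa using h
  refine eq_top_of_perp_of_radial (X := X) (w := gBr₄ l k 0 1 X) (fun i => ?_) ?_
    (Submodule.subset_span (by simp))
    ((isIteratedBracket_gBr₄ l k 0 1).snd_eq_zero (by norm_num) hX0) ?_
  · fin_cases i <;> exact Submodule.subset_span (by simp)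
  · have h01 := hrot 0 1 (Submodule.subset_span (by simp))
    have h02 := hrot 0 2 (Submodule.subset_span (by simp))
    rw [hX] at h01 h02 ⊢
    exact rotGen_mem_of_axis h01 h02
  · change radialPart _ X ≠ 0
    rw [radialPart_gBr₄ l k 0 1 hn]
    exact mul_ne_zero (by norm_num) hlk

/-! ### The distance along a trajectory -/

theorem LipschitzOnWith.comp_absolutelyContinuousOnInterval {F H : Type*}
    [SeminormedAddCommGroup F] [SeminormedAddCommGroup H] {g : F → H} {f : ℝ → F} {S : Set F}
    {K : NNReal} {a b : ℝ} (hg : LipschitzOnWith K g S)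
    (hf : AbsolutelyContinuousOnInterval f a b) (hS : MapsTo f (uIcc a b) S) :
    AbsolutelyContinuousOnInterval (fun t => g (f t)) a b := by
  rw [absolutelyContinuousOnInterval_iff] at hf ⊢
  intro ε hε
  obtain ⟨δ, hδ, h⟩ := hf (ε / (K + 1)) (by positivity)
  refine ⟨δ, hδ, fun E hE hEδ => ?_⟩
  calc ∑ i ∈ Finset.range E.1, dist (g (f (E.2 i).1)) (g (f (E.2 i).2))
      ≤ ∑ i ∈ Finset.range E.1, K * dist (f (E.2 i).1) (f (E.2 i).2) :=
        Finset.sum_le_sum fun i hi =>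
          hg.dist_le_mul _ (hS (hE.1 i hi).1) _ (hS (hE.1 i hi).2)
    _ = K * ∑ i ∈ Finset.range E.1, dist (f (E.2 i).1) (f (E.2 i).2) :=
        (Finset.mul_sum ..).symm
    _ ≤ K * (ε / (K + 1)) := by gcongr; exact (h E hE hEδ).le
    _ < (K + 1) * (ε / (K + 1)) := by gcongr; linarith
    _ = ε := by field

theorem AbsolutelyContinuousOnInterval.exp {A : ℝ → ℝ} {a b : ℝ}
    (hA : AbsolutelyContinuousOnInterval A a b) :
    AbsolutelyContinuousOnInterval (fun t => Real.exp (A t)) a b := by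
  obtain ⟨M, hM⟩ := hA.exists_bound
  obtain ⟨K, hK⟩ := (Real.contDiff_exp (n := 1)).contDiffOn.exists_lipschitzOnWith (by decide)
    (convex_Icc (-M) M) isCompact_Icc
  exact hK.comp_absolutelyContinuousOnInterval hA fun t ht => abs_le.1 (hM t ht)

/-- A scalar linear differential equation with integrable coefficient, whose solution is absolutely
continuous: the solution vanishes everywhere if it vanishes somewhere. -/
theorem eq_zero_of_ae_hasDerivAt_mul {u q : ℝ → ℝ} {a b t₀ : ℝ}
    (hu : AbsolutelyContinuousOnInterval u a b) (hq : IntervalIntegrable q volume a b)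
    (hd : ∀ᵐ t, t ∈ uIcc a b → HasDerivAt u (q t * u t) t) (ht₀ : t₀ ∈ uIcc a b)
    (h0 : u t₀ = 0) : ∀ t ∈ uIcc a b, u t = 0 := by
  -- multiplied by the integrating factor `exp (-∫ q)`, the solution is constant
  have hA := (hq.absolutelyContinuousOnInterval_intervalIntegral (c := a) left_mem_uIcc).fun_neg.exp
  obtain ⟨C, hC⟩ := (hu.fun_mul hA).const_of_ae_hasDerivAt_zero (by
    filter_upwards [hd, hq.ae_hasDerivAt_integral] with t h1 h2 ht
    refine ((h1 ht).mul ((h2 ht a left_mem_uIcc).neg.exp)).congr_deriv ?_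
    ring)
  have hC0 : C = 0 := by rw [← hC t₀ ht₀, h0, zero_mul]
  intro t ht
  exact (mul_eq_zero.1 ((hC t ht).trans hC0)).resolve_right (Real.exp_ne_zero _)

section Trajectories

variable {ι E : Type*} [Fintype ι] [NormedAddCommGroup E] [NormedSpace ℝ E] {g : ι → E → E}
  {P : Set E} {T : ℝ} {f : ℝ → EuclideanSpace ℝ ι} {X : ℝ → E}

theorem IntervalIntegrable.euclideanSpace_apply {a b : ℝ} (hf : IntervalIntegrable f volume a b)
    (i : ι) : IntervalIntegrable (fun t => f t i) volume a b :=
  ⟨(EuclideanSpace.proj i : EuclideanSpace ℝ ι →L[ℝ] ℝ).integrable_comp hf.1,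
    (EuclideanSpace.proj i : EuclideanSpace ℝ ι →L[ℝ] ℝ).integrable_comp hf.2⟩

theorem IsTrajectory.intervalIntegrable (h : IsTrajectory g P T f X) (hT : 0 ≤ T)
    (hg : ∀ i, ContinuousOn (g i) P) :
    IntervalIntegrable (fun s => ∑ i, f s i • g i (X s)) volume 0 T := by
  have := IntervalIntegrable.sum (μ := volume) (a := 0) (b := T) Finset.univ
    (f := fun i s => f s i • g i (X s)) fun i _ =>
      (h.control_integrable.euclideanSpace_apply i).smul_continuousOn
        (by rw [uIcc_of_le hT]; exact (hg i).comp h.continuousOn h.mem)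
  simpa [Finset.sum_fn] using this

theorem IsTrajectory.ae_hasDerivAt [CompleteSpace E] (h : IsTrajectory g P T f X) (hT : 0 ≤ T)
    (hg : ∀ i, ContinuousOn (g i) P) :
    ∀ᵐ t, t ∈ Icc 0 T → HasDerivAt X (∑ i, f t i • g i (X t)) t := by
  have hne : ∀ c : ℝ, ∀ᵐ t : ℝ, t ≠ c := fun c => by simp [ae_iff]
  filter_upwards [(h.intervalIntegrable hT hg).ae_hasDerivAt_integral, hne 0, hne T]
    with t ht h0 h1 htI
  have hI : t ∈ Ioo 0 T := ⟨htI.1.lt_of_ne' h0, htI.2.lt_of_ne h1⟩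
  refine ((ht (by rwa [uIcc_of_le hT]) 0 left_mem_uIcc).const_add
    (X 0)).congr_of_eventuallyEq ?_
  filter_upwards [Icc_mem_nhds hI.1 hI.2] with s hs using h.eq_integral s hs

end Trajectories

theorem continuousOn_tracerField {ρ : ℝ} (hρ : 0 ≤ ρ) (i : Fin 3) :
    ContinuousOn (tracerField i) (tracerStates ρ) := fun _ hX =>
  (contDiffAt_tracerField i (norm_pos_iff.1 (hρ.trans_lt hX))).continuousAt.continuousWithinAt

theorem sum_smul_tracerField (f : E3) (X : TracerState) :
    ∑ i, f i • tracerField i X = (stokeslet X.1 f - f, f) := by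
  have hf : f = ∑ i, f i • EuclideanSpace.single i (1 : ℝ) := by
    refine PiLp.ext fun m => ?_
    fin_cases m <;> simp [Fin.sum_univ_three]
  have hs : stokeslet X.1 f = ∑ i, f i • stokeslet X.1 (EuclideanSpace.single i 1) := by
    conv_lhs => rw [hf]
    simp only [stokeslet, Fin.sum_univ_three, inner_add_right, inner_smul_right]
    module
  refine Prod.ext ?_ ?_
  · conv_rhs => rw [hs]; rhs; rw [hf]
    simp [tracerField, Fin.sum_univ_three, smul_sub]
    abel
  · conv_rhs => rw [hf]
    simp [tracerField, Fin.sum_univ_three]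

section TracerTrajectories

variable {ρ T : ℝ} {f : ℝ → E3} {X : ℝ → TracerState}

theorem IsTrajectory.ae_hasDerivAt_norm_sq (hρ : 0 ≤ ρ) (hT : 0 ≤ T)
    (h : IsTrajectory tracerField (tracerStates ρ) T f X) :
    ∀ᵐ t, t ∈ Icc 0 T → HasDerivAt (fun s => ‖(X s).1‖ ^ 2)
      ((3 - 2 * ‖(X t).1‖) / ‖(X t).1‖ * inner ℝ (X t).1 (f t)) t := by
  filter_upwards [h.ae_hasDerivAt hT (continuousOn_tracerField hρ)] with t ht htI
  have hr : 0 < ‖(X t).1‖ := hρ.trans_lt (h.mem t htI)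
  have h1 := ((ContinuousLinearMap.fst ℝ E3 E3).hasFDerivAt.comp_hasDerivAt t (ht htI)).norm_sq
  simp only [Function.comp_apply, ContinuousLinearMap.coe_fst'] at h1
  rw [sum_smul_tracerField, inner_stokeslet_sub (norm_pos_iff.1 hr)] at h1
  refine h1.congr_deriv ?_
  field_simp

/-- The squared distance agrees on `[0, T]` with an absolutely continuous function. -/
theorem IsTrajectory.exists_absolutelyContinuous_norm_sq (hρ : 0 ≤ ρ) (hT : 0 ≤ T)
    (h : IsTrajectory tracerField (tracerStates ρ) T f X) :
    ∃ u : ℝ → ℝ, AbsolutelyContinuousOnInterval u 0 T ∧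
      ∀ t ∈ Icc 0 T, u t = ‖(X t).1‖ ^ 2 := by
  have hG := h.intervalIntegrable hT (continuousOn_tracerField hρ)
  set G : ℝ → TracerState := fun s => ∑ i, f s i • tracerField i (X s)
  let L : Fin 3 → TracerState →L[ℝ] ℝ := fun j =>
    (EuclideanSpace.proj j : E3 →L[ℝ] ℝ).comp (ContinuousLinearMap.fst ℝ E3 E3)
  have hLG : ∀ j, IntervalIntegrable (fun s => L j (G s)) volume 0 T := fun j =>
    ⟨(L j).integrable_comp hG.1, (L j).integrable_comp hG.2⟩
  have hac : ∀ j, AbsolutelyContinuousOnInterval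
      (fun t => L j (X 0) + ∫ s in (0 : ℝ)..t, L j (G s)) 0 T := fun j =>
    contDiffOn_const.absolutelyContinuousOnInterval.add
      ((hLG j).absolutelyContinuousOnInterval_intervalIntegral left_mem_uIcc)
  refine ⟨_, (((hac 0).fun_mul (hac 0)).fun_add ((hac 1).fun_mul (hac 1))).fun_add
    ((hac 2).fun_mul (hac 2)), fun t ht => ?_⟩
  have hGt : IntervalIntegrable G volume 0 t := hG.mono_set (by
    rw [uIcc_of_le hT, uIcc_of_le ht.1]; exact Icc_subset_Icc_right ht.2)
  have hj : ∀ j, L j (X 0) + ∫ s in (0 : ℝ)..t, L j (G s) = (X t).1 j := fun j => by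
    rw [(L j).intervalIntegral_comp_comm hGt, ← map_add, ← h.eq_integral t ht]
    rfl
  simp only [hj]
  rw [EuclideanSpace.norm_sq_eq]
  simp [Fin.sum_univ_three, sq]

/-- With `s = ‖r‖`, the function `u = s² - 9/4` satisfies `u' = q u` with the integrable coefficient
`q = -2 ⟪r, f⟫ / (s (s + 3/2))`. -/
theorem IsTrajectory.norm_eq_of_norm_eq (hρ : 0 ≤ ρ) (hT : 0 ≤ T)
    (h : IsTrajectory tracerField (tracerStates ρ) T f X) {t₀ : ℝ} (ht₀ : t₀ ∈ Icc 0 T)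
    (h0 : ‖(X t₀).1‖ = 3 / 2) : ∀ t ∈ Icc 0 T, ‖(X t).1‖ = 3 / 2 := by
  obtain ⟨u, hu, hueq⟩ := h.exists_absolutelyContinuous_norm_sq hρ hT
  have hpos : ∀ t ∈ Icc 0 T, 0 < ‖(X t).1‖ := fun t ht => hρ.trans_lt (h.mem t ht)
  have hq : IntervalIntegrable
      (fun t => ∑ i, f t i * (-2 / (‖(X t).1‖ * (‖(X t).1‖ + 3 / 2)) * (X t).1 i)) volume 0 T := by
    have := IntervalIntegrable.sum (μ := volume) (a := 0) (b := T) Finset.univ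
      (f := fun i t => f t i * (-2 / (‖(X t).1‖ * (‖(X t).1‖ + 3 / 2)) * (X t).1 i)) fun i _ => by
        refine (h.control_integrable.euclideanSpace_apply i).mul_continuousOn ?_
        rw [uIcc_of_le hT]
        have hr : ContinuousOn (fun t => (X t).1) (Icc 0 T) :=
          continuous_fst.comp_continuousOn h.continuousOn
        have hn := hr.norm
        refine (continuousOn_const.div (hn.mul (hn.add continuousOn_const)) fun t ht => ?_).mul
          ((EuclideanSpace.proj i : E3 →L[ℝ] ℝ).continuous.comp_continuousOn hr)
        have := hpos t ht
        change ‖(X t).1‖ * (‖(X t).1‖ + 3 / 2) ≠ 0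
        positivity
    simpa [Finset.sum_fn] using this
  have hv : ∀ t ∈ uIcc 0 T, u t - 9 / 4 = 0 := by
    refine eq_zero_of_ae_hasDerivAt_mul (u := fun t => u t - 9 / 4)
      (hu.sub contDiffOn_const.absolutelyContinuousOnInterval) hq ?_
      (by rwa [uIcc_of_le hT]) (by rw [hueq t₀ ht₀, h0]; norm_num)
    have hne : ∀ c : ℝ, ∀ᵐ t : ℝ, t ≠ c := fun c => by simp [ae_iff]
    filter_upwards [h.ae_hasDerivAt_norm_sq hρ hT, hne 0, hne T] with t ht hne0 hneT htI
    rw [uIcc_of_le hT] at htI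
    have hs := hpos t htI
    have hI : t ∈ Ioo 0 T := ⟨htI.1.lt_of_ne' hne0, htI.2.lt_of_ne hneT⟩
    refine (((ht htI).congr_of_eventuallyEq ?_).sub_const (9 / 4)).congr_deriv ?_
    · filter_upwards [Icc_mem_nhds hI.1 hI.2] with s hs using hueq s hs
    · have hin : inner ℝ (X t).1 (f t) = ∑ i, f t i * (X t).1 i := by
        simp [PiLp.inner_apply]
      rw [hin, hueq t htI, Fin.sum_univ_three, Fin.sum_univ_three]
      field_simp
      ring
  intro t ht
  have h1 := hv t (by rwa [uIcc_of_le hT])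
  rw [hueq t ht] at h1
  nlinarith [hpos t ht]

end TracerTrajectories

theorem not_isControllableWithin {ρ : ℝ} (hρ : 0 ≤ ρ) {Q : Set TracerState}
    {X₀ X₁ : TracerState} (h₀ : X₀ ∈ Q) (hX₀ : ‖X₀.1‖ = 3 / 2) (h₁ : X₁ ∈ Q)
    (hX₁ : ‖X₁.1‖ ≠ 3 / 2) : ¬ IsControllableWithin tracerField (tracerStates ρ) Q := by
  intro hQ
  obtain ⟨f, X, -, hX, h0, h1⟩ := hQ X₀ h₀ X₁ h₁ 1 one_pos
  refine hX₁ (h1 ▸ hX.norm_eq_of_norm_eq hρ zero_le_one (left_mem_Icc.2 zero_le_one) (h0 ▸ hX₀) 1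
    (right_mem_Icc.2 zero_le_one))

theorem not_isControllableWithin_nhds {ρ : ℝ} (hρ : 0 ≤ ρ) {X₀ : TracerState}
    (h₀ : X₀ ∈ tracerStates ρ) (hX₀ : ‖X₀.1‖ = 3 / 2) {U : Set TracerState} (hU : U ∈ 𝓝 X₀) :
    ¬ IsControllableWithin tracerField (tracerStates ρ) (U ∩ tracerStates ρ) := by
  have hopen : IsOpen (tracerStates ρ) := isOpen_lt continuous_const continuous_fst.norm
  have hUP : U ∩ tracerStates ρ ∈ 𝓝 X₀ := Filter.inter_mem hU (hopen.mem_nhds h₀)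
  -- scaling the tracer position slightly leaves the sphere `‖r‖ = 3 / 2` but not the neighbourhood
  have hc : ContinuousAt (fun c : ℝ => ((c • X₀.1, X₀.2) : TracerState)) 1 := by fun_prop
  have hev : ∀ᶠ c in 𝓝[≠] (1 : ℝ), ((c • X₀.1, X₀.2) : TracerState) ∈ U ∩ tracerStates ρ :=
    nhdsWithin_le_nhds (hc (by simpa using hUP))
  have hev2 : ∀ᶠ c in 𝓝[≠] (1 : ℝ), 0 < c := nhdsWithin_le_nhds (lt_mem_nhds one_pos)
  obtain ⟨c, ⟨hcU, hc0⟩, hc1⟩ := ((hev.and hev2).and self_mem_nhdsWithin).exists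
  refine not_isControllableWithin hρ (mem_of_mem_nhds hUP) hX₀ hcU fun h => hc1 ?_
  simp only [norm_smul, Real.norm_of_nonneg hc0.le, hX₀] at h
  rw [mem_singleton_iff]
  linarith

/-! ### Joining states by explicit trajectories -/

section Joinable

variable {ι E : Type*} [Fintype ι] [NormedAddCommGroup E] [NormedSpace ℝ E] {g : ι → E → E}
  {P : Set E}

/-- The states `X₀` and `X₁` are joined, in any prescribed time, by a trajectory in `P` whose
control is measurable and bounded on the whole line. -/
def IsJoinable (g : ι → E → E) (P : Set E) (X₀ X₁ : E) : Prop :=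
  ∀ T : ℝ, 0 < T → ∃ (f : ℝ → EuclideanSpace ℝ ι) (X : ℝ → E),
    Measurable f ∧ (∃ C, ∀ t, ‖f t‖ ≤ C) ∧ IsTrajectory g P T f X ∧ X 0 = X₀ ∧ X T = X₁

theorem isControllableWithin_of_isJoinable {Q : Set E}
    (h : ∀ X₀ ∈ Q, ∀ X₁ ∈ Q, IsJoinable g P X₀ X₁) : IsControllableWithin g P Q := by
  intro X₀ h₀ X₁ h₁ T hT
  obtain ⟨f, X, hf, ⟨C, hC⟩, hX⟩ := h X₀ h₀ X₁ h₁ T hT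
  exact ⟨f, X, memLp_top_of_bound hf.aestronglyMeasurable C (.of_forall hC), hX⟩

theorem intervalIntegrable_of_measurable_of_bound {f : ℝ → EuclideanSpace ℝ ι}
    (hf : Measurable f) {C : ℝ} (hC : ∀ t, ‖f t‖ ≤ C) (a b : ℝ) :
    IntervalIntegrable f volume a b :=
  (intervalIntegrable_const (c := C)).mono_fun hf.aestronglyMeasurable
    (.of_forall fun t => (hC t).trans (Real.le_norm_self C))

/-- Concatenation of trajectories. -/
theorem IsJoinable.trans (hg : ∀ i, ContinuousOn (g i) P) {X₀ X₁ X₂ : E}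
    (h₁ : IsJoinable g P X₀ X₁) (h₂ : IsJoinable g P X₁ X₂) : IsJoinable g P X₀ X₂ := by
  intro T hT
  set a := T / 2 with ha
  have ha0 : 0 < a := by positivity
  obtain ⟨f, X, hfm, ⟨C, hC⟩, hX, hX0, hXa⟩ := h₁ a ha0
  obtain ⟨f', X', hfm', ⟨C', hC'⟩, hX', hX'0, hX'a⟩ := h₂ a ha0
  let F : ℝ → EuclideanSpace ℝ ι := fun t => if t ≤ a then f t else f' (t - a)
  let Y : ℝ → E := fun t => if t ≤ a then X t else X' (t - a)
  have hFm : Measurable F :=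
    Measurable.ite measurableSet_Iic hfm (hfm'.comp (measurable_id.sub_const a))
  have hFb : ∀ t, ‖F t‖ ≤ max C C' := fun t => by
    by_cases ht : t ≤ a
    · simpa [F, ht] using Or.inl (hC t)
    · simpa [F, ht] using Or.inr (hC' (t - a))
  have hY1 : EqOn Y X (Icc 0 a) := fun t ht => by simp [Y, ht.2]
  have hY2 : EqOn Y (fun t => X' (t - a)) (Icc a T) := fun t ht => by
    rcases ht.1.eq_or_lt with rfl | h
    · simp [Y, hXa, hX'0]
    · simp [Y, h.not_ge]
  have hsub : ∀ t ∈ Icc a T, t - a ∈ Icc 0 a := fun t ht =>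
    ⟨by linarith [ht.1], by linarith [ht.2]⟩
  have hfirst : ∀ t ∈ Icc 0 a, Y t = Y 0 + ∫ s in (0 : ℝ)..t, ∑ i, F s i • g i (Y s) :=
    fun t ht => by
      rw [hY1 ht, hY1 (left_mem_Icc.2 ha0.le), hX.eq_integral t ht]
      congr 1
      refine intervalIntegral.integral_congr fun s hs => ?_
      rw [uIcc_of_le ht.1] at hs
      have hsa : s ≤ a := hs.2.trans ht.2
      simp [F, Y, hsa]
  refine ⟨F, Y, hFm, ⟨_, hFb⟩,
    ⟨intervalIntegrable_of_measurable_of_bound hFm hFb 0 T, ?_, ?_, ?_⟩, ?_, ?_⟩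
  · have hun : Icc 0 T = Icc 0 a ∪ Icc a T :=
      (Icc_union_Icc_eq_Icc ha0.le (by linarith)).symm
    rw [hun]
    refine (hX.continuousOn.congr hY1).union_of_isClosed (ContinuousOn.congr ?_ hY2)
      isClosed_Icc isClosed_Icc
    exact hX'.continuousOn.comp (continuous_id.sub continuous_const).continuousOn hsub
  · intro t ht
    rcases le_total t a with h | h
    · rw [hY1 ⟨ht.1, h⟩]; exact hX.mem t ⟨ht.1, h⟩
    · rw [hY2 ⟨h, ht.2⟩]; exact hX'.mem _ (hsub t ⟨h, ht.2⟩)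
  · intro t ht
    rcases le_total t a with h | h
    · exact hfirst t ⟨ht.1, h⟩
    have hta := hsub t ⟨h, ht.2⟩
    have hcongr : ∀ s ∈ uIoc a t,
        ∑ i, F s i • g i (Y s) = ∑ i, f' (s - a) i • g i (X' (s - a)) := fun s hs => by
      rw [uIoc_of_le h] at hs
      simp [F, Y, hs.1.not_ge]
    have hI1 : IntervalIntegrable (fun s => ∑ i, F s i • g i (Y s)) volume 0 a := by
      refine (hX.intervalIntegrable ha0.le hg).congr fun s hs => ?_
      rw [uIoc_of_le ha0.le] at hs
      simp [F, Y, hs.2]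
    have hI2 : IntervalIntegrable (fun s => ∑ i, F s i • g i (Y s)) volume a t := by
      have h2 : IntervalIntegrable (fun s => ∑ i, f' s i • g i (X' s)) volume 0 (t - a) :=
        (hX'.intervalIntegrable ha0.le hg).mono_set (by
          rw [uIcc_of_le hta.1, uIcc_of_le ha0.le]; exact Icc_subset_Icc_right hta.2)
      have h3 := h2.comp_sub_right a
      rw [zero_add, sub_add_cancel] at h3
      exact h3.congr fun s hs => (hcongr s hs).symm
    rw [← intervalIntegral.integral_add_adjacent_intervals hI1 hI2, ← add_assoc,
      ← hfirst a (right_mem_Icc.2 ha0.le), intervalIntegral.integral_congr_ae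
      (.of_forall hcongr), intervalIntegral.integral_comp_sub_right
      (fun s => ∑ i, f' s i • g i (X' s)), sub_self, hY1 (right_mem_Icc.2 ha0.le), hXa, ← hX'0,
      ← hX'.eq_integral _ hta]
    exact hY2 ⟨h, ht.2⟩
  · rw [hY1 (left_mem_Icc.2 ha0.le), hX0]
  · rw [hY2 ⟨by linarith, le_rfl⟩, ← hX'a]
    exact congrArg X' (by linarith)

/-- A curve solving the equation with a continuous control joins its end points: the prescribed
time is met by rescaling. -/
theorem IsJoinable.of_curve [CompleteSpace E] (hg : ∀ i, ContinuousOn (g i) P) {γ : ℝ → E}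
    {F : ℝ → EuclideanSpace ℝ ι} (hF : ContinuousOn F (Icc 0 1))
    (hγ : ∀ t ∈ Icc (0 : ℝ) 1, HasDerivAt γ (∑ i, F t i • g i (γ t)) t)
    (hP : ∀ t ∈ Icc (0 : ℝ) 1, γ t ∈ P) : IsJoinable g P (γ 0) (γ 1) := by
  intro T hT
  have hmem : ∀ t ∈ Icc 0 T, t / T ∈ Icc (0 : ℝ) 1 := fun t ht =>
    ⟨div_nonneg ht.1 hT.le, (div_le_one hT).2 ht.2⟩
  have hdiv : ContinuousOn (fun t : ℝ => t / T) (Icc 0 T) := by fun_prop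
  have hFT : ContinuousOn (fun t => (1 / T) • F (t / T)) (Icc 0 T) :=
    ContinuousOn.smul (f := fun _ => 1 / T) (g := fun t => F (t / T)) continuousOn_const
      (hF.comp hdiv hmem)
  have hγT : ContinuousOn (fun t => γ (t / T)) (Icc 0 T) :=
    ContinuousOn.comp (fun t ht => (hγ t ht).continuousAt.continuousWithinAt) hdiv hmem
  let f : ℝ → EuclideanSpace ℝ ι := (Icc 0 T).piecewise (fun t => (1 / T) • F (t / T)) 0
  have hfm : Measurable f := hFT.measurable_piecewise continuousOn_const measurableSet_Icc
  have hfeq : ∀ t ∈ Icc 0 T, f t = (1 / T) • F (t / T) := fun t ht => piecewise_eq_of_mem _ _ _ ht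
  obtain ⟨C, hC⟩ := isCompact_Icc.exists_bound_of_continuousOn hFT
  have hfb : ∀ t, ‖f t‖ ≤ max C 0 := fun t => by
    by_cases ht : t ∈ Icc 0 T
    · rw [hfeq t ht]; exact (hC t ht).trans (le_max_left _ _)
    · rw [show f t = 0 from piecewise_eq_of_notMem _ _ _ ht, norm_zero]
      exact le_max_right _ _
  have hd : ∀ t ∈ Icc 0 T,
      HasDerivAt (fun t => γ (t / T)) (∑ i, f t i • g i (γ (t / T))) t := fun t ht => by
    refine ((hγ _ (hmem t ht)).scomp t ((hasDerivAt_id t).div_const T)).congr_deriv ?_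
    simp [hfeq t ht, Finset.smul_sum, smul_smul]
  have hcont : ContinuousOn (fun t => ∑ i, f t i • g i (γ (t / T))) (Icc 0 T) := by
    refine continuousOn_finsetSum _ fun i _ => ContinuousOn.smul ?_ ?_
    · exact (EuclideanSpace.proj i : EuclideanSpace ℝ ι →L[ℝ] ℝ).continuous.comp_continuousOn
        (hFT.congr hfeq)
    · exact (hg i).comp hγT fun t ht => hP _ (hmem t ht)
  refine ⟨f, fun t => γ (t / T), hfm, ⟨_, hfb⟩,
    ⟨intervalIntegrable_of_measurable_of_bound hfm hfb 0 T, hγT, fun t ht => hP _ (hmem t ht),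
      fun t ht => ?_⟩, by simp, by simp [hT.ne']⟩
  have hsub : uIcc 0 t ⊆ Icc 0 T := by
    rw [uIcc_of_le ht.1]; exact Icc_subset_Icc_right ht.2
  rw [intervalIntegral.integral_eq_sub_of_hasDerivAt (fun s hs => hd s (hsub hs))
    (hcont.mono hsub).intervalIntegrable]
  simp

end Joinable

theorem exists_unit_orthogonal (w : E3) : ∃ u : E3, ‖u‖ = 1 ∧ inner ℝ w u = 0 := by
  have hlt : Module.finrank ℝ (ℝ ∙ w) < Module.finrank ℝ E3 :=
    (finrank_span_le_card {w}).trans_lt (by simp)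
  have hne : (ℝ ∙ w)ᗮ ≠ ⊥ := fun h => by
    rw [Submodule.orthogonal_eq_bot_iff] at h
    rw [h, finrank_top] at hlt
    exact lt_irrefl _ hlt
  obtain ⟨u, hu, hu0⟩ := Submodule.exists_mem_ne_zero_of_ne_bot hne
  refine ⟨‖u‖⁻¹ • u, norm_smul_inv_norm (𝕜 := ℝ) hu0, ?_⟩
  rw [inner_smul_right, Submodule.mem_orthogonal_singleton_iff_inner_right.1 hu, mul_zero]

/-- Every vector of length at most two is a difference of two unit vectors. -/
theorem exists_unit_sub_unit_eq {v : E3} (hv : ‖v‖ ≤ 2) :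
    ∃ a b : E3, ‖a‖ = 1 ∧ ‖b‖ = 1 ∧ a - b = v := by
  obtain ⟨u, hu, hwu⟩ := exists_unit_orthogonal v
  have hnn : 0 ≤ 1 - (‖v‖ / 2) ^ 2 := by nlinarith [norm_nonneg v]
  have hn : ∀ ε : ℝ, ε ^ 2 = 1 / 4 → ‖√(1 - (‖v‖ / 2) ^ 2) • u + ε • v‖ = 1 := fun ε hε => by
    have h : ‖√(1 - (‖v‖ / 2) ^ 2) • u + ε • v‖ ^ 2 = 1 := by
      rw [norm_add_sq_real, inner_smul_left, inner_smul_right, real_inner_comm, hwu, norm_smul,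
        norm_smul, mul_pow, mul_pow, hu, Real.norm_eq_abs, Real.norm_eq_abs, sq_abs, sq_abs,
        Real.sq_sqrt hnn, hε]
      ring
    exact (pow_eq_one_iff_of_nonneg (norm_nonneg _) two_ne_zero).1 h
  -- `a` and `b` are `±v / 2` plus a common vector orthogonal to `v`
  refine ⟨_, _, hn (1 / 2) (by norm_num), hn (-(1 / 2)) (by norm_num), ?_⟩
  module

/-- Two unit vectors lie on a common great circle. -/
theorem exists_great_circle {n n' : E3} (hn : ‖n‖ = 1) (hn' : ‖n'‖ = 1) :
    ∃ (m : E3) (θ : ℝ), ‖m‖ = 1 ∧ inner ℝ n m = 0 ∧ n' = Real.cos θ • n + Real.sin θ • m := by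
  set c := inner ℝ n n' with hc
  have habs : |c| ≤ 1 := by simpa [hn, hn'] using abs_real_inner_le_norm n n'
  set w := n' - c • n with hw
  have hnw : inner ℝ n w = 0 := by
    rw [hw, inner_sub_right, inner_smul_right, real_inner_self_eq_norm_sq, hn]; simp [hc]
  have hw2 : ‖w‖ = √(1 - c ^ 2) := by
    rw [eq_comm, Real.sqrt_eq_iff_mul_self_eq (by nlinarith [abs_le.1 habs]) (norm_nonneg _), ← sq,
      hw, norm_sub_sq_real, inner_smul_right, real_inner_comm, ← hc, norm_smul, hn, hn',
      Real.norm_eq_abs, mul_one, sq_abs]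
    ring
  obtain ⟨m, hm1, hm0, hm⟩ : ∃ m : E3, ‖m‖ = 1 ∧ inner ℝ n m = 0 ∧ w = ‖w‖ • m := by
    by_cases h : w = 0
    · obtain ⟨m, h1, h2⟩ := exists_unit_orthogonal n
      exact ⟨m, h1, h2, by simp [h]⟩
    · refine ⟨‖w‖⁻¹ • w, norm_smul_inv_norm (𝕜 := ℝ) h, ?_, ?_⟩
      · rw [inner_smul_right, hnw, mul_zero]
      · rw [smul_inv_smul₀ (norm_ne_zero_iff.2 h)]
  refine ⟨m, Real.arccos c, hm1, hm0, ?_⟩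
  rw [Real.cos_arccos (abs_le.1 habs).1 (abs_le.1 habs).2, Real.sin_arccos, ← hw2, ← hm, hw]
  abel

theorem stokeslet_sub_of_inner_eq_zero {r f : E3} (h : inner ℝ r f = 0) :
    stokeslet r f - f = (3 / (4 * ‖r‖) - 1) • f := by
  rw [stokeslet, h, zero_div, zero_smul, add_zero]
  rw [smul_smul, sub_smul, one_smul]
  congr 2
  ring

theorem stokeslet_sub_of_parallel {n : E3} (hn : ‖n‖ = 1) {s : ℝ} (hs : 0 < s) (φ : ℝ) :
    stokeslet (s • n) (φ • n) - φ • n = ((3 / (2 * s) - 1) * φ) • n := by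
  rw [stokeslet, norm_smul, hn, mul_one, Real.norm_of_nonneg hs.le, inner_smul_left,
    inner_smul_right, real_inner_self_eq_norm_sq, hn]
  match_scalars
  simp
  field_simp
  ring

/-- The sphere moves by `(radialShift s₁ - radialShift s₀) n` while the tracer moves radially
from `s₀ n` to `s₁ n`. As `Real.log` is the logarithm of the absolute value, the formula serves on
both sides of `s = 3 / 2`. -/
def radialShift (s : ℝ) : ℝ := -s - 3 / 2 * Real.log (3 - 2 * s)

theorem hasDerivAt_radialShift {s : ℝ} (hs : s ≠ 3 / 2) :
    HasDerivAt radialShift (2 * s / (3 - 2 * s)) s := by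
  have h0 : 3 - 2 * s ≠ 0 := fun h => hs (by linarith)
  have h := (hasDerivAt_id s).neg.sub
    (((((hasDerivAt_id s).const_mul 2).const_sub 3).log h0).const_mul (3 / 2))
  refine h.congr_deriv ?_
  simp only [id]
  field_simp
  ring

/-- The sphere moves by `sphericalShift s • (n₁ - n₀)` while the tracer moves on the sphere of
radius `s` from `s n₀` to `s n₁`. At `s = 3 / 4` the tracer cannot be moved this way, and the value
is a junk one. -/
def sphericalShift (s : ℝ) : ℝ := 4 * s ^ 2 / (3 - 4 * s)

theorem hasDerivAt_sphericalShift {s : ℝ} (hs : s ≠ 3 / 4) :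
    HasDerivAt sphericalShift (8 * s * (3 - 2 * s) / (3 - 4 * s) ^ 2) s := by
  have h0 : 3 - 4 * s ≠ 0 := fun h => hs (by linarith)
  have h := (((hasDerivAt_id s).pow 2).const_mul 4).div
    (((hasDerivAt_id s).const_mul 4).const_sub 3) h0
  refine h.congr_deriv ?_
  simp only [id, Pi.pow_apply]
  field_simp
  ring

section Moves

variable {ρ : ℝ}

theorem isJoinable_radial (hρ : 0 ≤ ρ) {J : Set ℝ} (hJ : J.OrdConnected)
    (hJρ : ∀ s ∈ J, ρ < s ∧ s ≠ 3 / 2) {s₀ s₁ : ℝ} (h₀ : s₀ ∈ J) (h₁ : s₁ ∈ J) {n : E3}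
    (hn : ‖n‖ = 1) (x : E3) :
    IsJoinable tracerField (tracerStates ρ) (s₀ • n, x)
      (s₁ • n, x + (radialShift s₁ - radialShift s₀) • n) := by
  let σ : ℝ → ℝ := fun t => s₀ + t * (s₁ - s₀)
  have hσ : ∀ t ∈ Icc (0 : ℝ) 1, σ t ∈ J := fun t ht => hJ.convex.add_smul_sub_mem h₀ h₁ ht
  have hσ' : ∀ t, HasDerivAt σ (s₁ - s₀) t := fun t =>
    (((hasDerivAt_id t).mul_const (s₁ - s₀)).const_add s₀).congr_deriv (one_mul _)
  have hσc : Continuous σ := by fun_prop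
  let φ : ℝ → ℝ := fun t => 2 * σ t / (3 - 2 * σ t) * (s₁ - s₀)
  have hne : ∀ t ∈ Icc (0 : ℝ) 1, 3 - 2 * σ t ≠ 0 := fun t ht h =>
    (hJρ _ (hσ t ht)).2 (by linarith)
  have h := IsJoinable.of_curve (g := tracerField) (P := tracerStates ρ)
    (continuousOn_tracerField hρ)
    (γ := fun t => (σ t • n, x + (radialShift (σ t) - radialShift s₀) • n))
    (F := fun t => φ t • n) ?_ ?_ ?_
  · simpa [σ] using h
  · refine ContinuousOn.smul (ContinuousOn.mul (ContinuousOn.div ?_ ?_ hne) continuousOn_const)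
      continuousOn_const <;> fun_prop
  · intro t ht
    have hpos : 0 < σ t := hρ.trans_lt (hJρ _ (hσ t ht)).1
    rw [sum_smul_tracerField]
    refine (((hσ' t).smul_const n).prodMk (((((hasDerivAt_radialShift (hJρ _ (hσ t ht)).2).comp t
      (hσ' t)).sub_const _).smul_const n).const_add x)).congr_deriv ?_
    refine Prod.ext ?_ rfl
    simp only [stokeslet_sub_of_parallel hn hpos, φ]
    congr 1
    have := hne t ht
    field_simp
  · intro t ht
    have hpos := (hJρ _ (hσ t ht)).1
    change ρ < ‖σ t • n‖
    rwa [norm_smul, hn, mul_one, Real.norm_of_nonneg (hρ.trans hpos.le)]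

theorem isJoinable_spherical (hρ : 0 ≤ ρ) {s : ℝ} (hs : ρ < s) (hs' : s ≠ 3 / 4) {n n' : E3}
    (hn : ‖n‖ = 1) (hn' : ‖n'‖ = 1) (x : E3) :
    IsJoinable tracerField (tracerStates ρ) (s • n, x)
      (s • n', x + sphericalShift s • (n' - n)) := by
  obtain ⟨m, θ, hm, hnm, hθ⟩ := exists_great_circle hn hn'
  have hs0 : 0 < s := hρ.trans_lt hs
  have hne : 3 - 4 * s ≠ 0 := fun h => hs' (by linarith)
  let ν : ℝ → E3 := fun t => Real.cos (t * θ) • n + Real.sin (t * θ) • m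
  let ν' : ℝ → E3 := fun t => (-Real.sin (t * θ) * θ) • n + (Real.cos (t * θ) * θ) • m
  have hν : ∀ t, HasDerivAt ν (ν' t) t := fun t => by
    have h := (hasDerivAt_id t).mul_const θ
    simp only [id, one_mul] at h
    exact (h.cos.smul_const n).add (h.sin.smul_const m)
  have hmn : inner ℝ m n = 0 := by rw [real_inner_comm, hnm]
  have hnorm : ∀ t, ‖ν t‖ = 1 := fun t => by
    have h : ‖ν t‖ ^ 2 = 1 := by
      simp only [ν]
      rw [norm_add_sq_real, inner_smul_left, inner_smul_right, hnm, norm_smul, norm_smul, hn, hm,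
        Real.norm_eq_abs, Real.norm_eq_abs, mul_one, mul_one, sq_abs, sq_abs]
      simp
    exact (pow_eq_one_iff_of_nonneg (norm_nonneg _) two_ne_zero).1 h
  have horth : ∀ t, inner ℝ (ν t) (ν' t) = 0 := fun t => by
    simp only [ν, ν', inner_add_left, inner_add_right, inner_smul_left, inner_smul_right, hnm, hmn,
      real_inner_self_eq_norm_sq, hn, hm, conj_trivial]
    ring
  have hsν : ∀ t, ‖s • ν t‖ = s := fun t => by
    rw [norm_smul, hnorm, mul_one, Real.norm_of_nonneg hs0.le]
  have h := IsJoinable.of_curve (g := tracerField) (P := tracerStates ρ)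
    (continuousOn_tracerField hρ)
    (γ := fun t => (s • ν t, x + sphericalShift s • (ν t - n)))
    (F := fun t => sphericalShift s • ν' t) ?_ ?_ ?_
  · simpa [ν, ← hθ] using h
  · fun_prop
  · intro t _
    rw [sum_smul_tracerField]
    refine (((hν t).const_smul s).prodMk
      ((((hν t).sub_const n).const_smul (sphericalShift s)).const_add x)).congr_deriv ?_
    refine Prod.ext ?_ rfl
    simp only
    rw [stokeslet_sub_of_inner_eq_zero (by
      rw [inner_smul_left, inner_smul_right, horth, mul_zero, mul_zero]), hsν, smul_smul]
    congr 1
    rw [sphericalShift, mul_div_assoc', eq_div_iff hne]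
    field_simp
  · intro t _
    change ρ < ‖s • ν t‖
    rwa [hsν]

/-- A loop of the tracer between the radii `s` and `s'` translates the sphere by a vector
proportional to `loopShift s - loopShift s'`. -/
def loopShift (s : ℝ) : ℝ := sphericalShift s - radialShift s

/-- The loop made of two arcs, on the spheres of radii `s` and `s'`, and two radial segments. -/
theorem isJoinable_loop (hρ : 0 ≤ ρ) {J : Set ℝ} (hJ : J.OrdConnected)
    (hJρ : ∀ s ∈ J, ρ < s ∧ s ≠ 3 / 2) {s s' : ℝ} (hs : s ∈ J) (hs' : s' ∈ J) (h : s ≠ 3 / 4)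
    (h' : s' ≠ 3 / 4) {n a b : E3} (hn : ‖n‖ = 1) (ha : ‖a‖ = 1) (hb : ‖b‖ = 1) (x : E3) :
    IsJoinable tracerField (tracerStates ρ) (s • n, x)
      (s • n, x + (loopShift s - loopShift s') • (a - b)) := by
  have hg := continuousOn_tracerField hρ
  have hsρ := (hJρ s hs).1
  have hsρ' := (hJρ s' hs').1
  have key := ((((isJoinable_spherical hρ hsρ h hn ha x).trans hg
    (isJoinable_radial hρ hJ hJρ hs hs' ha _)).trans hg
    (isJoinable_spherical hρ hsρ' h' ha hb _)).trans hg
    (isJoinable_radial hρ hJ hJρ hs' hs hb _)).trans hg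
    (isJoinable_spherical hρ hsρ h hb hn _)
  convert key using 2
  simp only [loopShift]
  module

/-- A single loop gives all translations of length at most `2 |loopShift s - loopShift s'|`; longer
ones are obtained by repeating it. -/
theorem isJoinable_translation (hρ : 0 ≤ ρ) {J : Set ℝ} (hJ : J.OrdConnected)
    (hJρ : ∀ s ∈ J, ρ < s ∧ s ≠ 3 / 2) {s s' : ℝ} (hs : s ∈ J) (hs' : s' ∈ J) (h : s ≠ 3 / 4)
    (h' : s' ≠ 3 / 4) (hK : loopShift s ≠ loopShift s') {n : E3} (hn : ‖n‖ = 1) (x y : E3) :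
    IsJoinable tracerField (tracerStates ρ) (s • n, x) (s • n, y) := by
  set K := loopShift s - loopShift s' with hKdef
  have hK0 : K ≠ 0 := sub_ne_zero.2 hK
  have hsmall : ∀ v : E3, ‖v‖ ≤ 2 → ∀ x,
      IsJoinable tracerField (tracerStates ρ) (s • n, x) (s • n, x + K • v) := fun v hv x => by
    obtain ⟨a, b, ha, hb, rfl⟩ := exists_unit_sub_unit_eq hv
    exact isJoinable_loop hρ hJ hJρ hs hs' h h' hn ha hb x
  have hiter : ∀ (N : ℕ) (v : E3), ‖v‖ ≤ 2 → ∀ x,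
      IsJoinable tracerField (tracerStates ρ) (s • n, x)
        (s • n, x + ((N : ℝ) + 1) • K • v) := fun N v hv => by
    induction N with
    | zero => simpa using hsmall v hv
    | succ N ih =>
      intro x
      convert (ih x).trans (continuousOn_tracerField hρ) (hsmall v hv _) using 2
      push_cast
      module
  obtain ⟨N, hN⟩ := exists_nat_ge ‖K⁻¹ • (y - x)‖
  have hN1 : (N : ℝ) + 1 ≠ 0 := by positivity
  convert hiter N (((N : ℝ) + 1)⁻¹ • K⁻¹ • (y - x)) ?_ x using 2
  · rw [smul_comm K, smul_inv_smul₀ hN1, smul_inv_smul₀ hK0, add_sub_cancel]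
  · rw [norm_smul, norm_inv, Real.norm_of_nonneg (by positivity : (0 : ℝ) ≤ N + 1)]
    have : 0 < (N : ℝ) + 1 := by positivity
    rw [inv_mul_le_iff₀ this]
    linarith

/-- The derivative of `loopShift` vanishes only at `9 / 8`, so it is not constant near any other
radius. -/
theorem exists_loopShift_ne {J : Set ℝ} (hJ : IsOpen J) (hne : J.Nonempty)
    (hJρ : ∀ s ∈ J, 0 < s ∧ s ≠ 3 / 2) :
    ∃ s ∈ J, ∃ s' ∈ J, s ≠ 3 / 4 ∧ s' ≠ 3 / 4 ∧ loopShift s ≠ loopShift s' := by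
  obtain ⟨s₀, hs₀⟩ := hne
  have hev : ∀ c : ℝ, ∀ s ∈ J, ∀ᶠ s' in 𝓝[≠] s, s' ∈ J ∧ (s ≠ c → s' ≠ c) := fun c s hs => by
    refine nhdsWithin_le_nhds ((hJ.eventually_mem hs).and ?_)
    by_cases h : s = c
    · simp [h]
    · filter_upwards [isOpen_ne.mem_nhds h] with s' h' _ using h'
  obtain ⟨s, hs, h1, h2⟩ : ∃ s ∈ J, s ≠ 3 / 4 ∧ s ≠ 9 / 8 := by
    have hinf : J.Infinite := infinite_of_mem_nhds s₀ (hJ.mem_nhds hs₀)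
    obtain ⟨s, hs, hs'⟩ := hinf.exists_notMem_finset {3 / 4, 9 / 8}
    simp only [Finset.mem_insert, Finset.mem_singleton, not_or] at hs'
    exact ⟨s, hs, hs'⟩
  obtain ⟨hpos, h3⟩ := hJρ s hs
  have hd := (hasDerivAt_sphericalShift h1).sub (hasDerivAt_radialShift h3)
  have hd0 : 8 * s * (3 - 2 * s) / (3 - 4 * s) ^ 2 - 2 * s / (3 - 2 * s) ≠ 0 := by
    have e1 : 3 - 4 * s ≠ 0 := fun h => h1 (by linarith)
    have e2 : 3 - 2 * s ≠ 0 := fun h => h3 (by linarith)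
    rw [div_sub_div _ _ (pow_ne_zero 2 e1) e2]
    refine div_ne_zero (fun h => ?_) (mul_ne_zero (pow_ne_zero 2 e1) e2)
    have h27 : s * (27 - 24 * s) = 0 := by linear_combination h / 2
    exact h2 (by linarith [(mul_eq_zero.1 h27).resolve_left hpos.ne'])
  obtain ⟨s', h4, h5, h6⟩ := ((hd.eventually_ne (c := loopShift s) hd0).and
    (hev (3 / 4) s hs)).exists
  exact ⟨s, hs, s', h5, h1, h6 h1, fun h => h4 h.symm⟩

/-- Bring the tracer radially to a suitable distance, rotate it there, correct the position of the
sphere by loops, and bring the tracer radially to its final distance. -/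
theorem isJoinable_of_norm_mem (hρ : 0 ≤ ρ) {J : Set ℝ} (hJo : IsOpen J) (hJ : J.OrdConnected)
    (hJρ : ∀ s ∈ J, ρ < s ∧ s ≠ 3 / 2) {X₀ X₁ : TracerState} (h₀ : ‖X₀.1‖ ∈ J)
    (h₁ : ‖X₁.1‖ ∈ J) : IsJoinable tracerField (tracerStates ρ) X₀ X₁ := by
  obtain ⟨s, hs, s', hs', h, h', hK⟩ := exists_loopShift_ne hJo ⟨_, h₀⟩
    fun s hs => ⟨hρ.trans_lt (hJρ s hs).1, (hJρ s hs).2⟩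
  have hg := continuousOn_tracerField hρ
  have hunit : ∀ X : TracerState, ‖X.1‖ ∈ J → ‖‖X.1‖⁻¹ • X.1‖ = 1 ∧
      X = (‖X.1‖ • ‖X.1‖⁻¹ • X.1, X.2) := fun X hX => by
    have hX0 : X.1 ≠ 0 := norm_pos_iff.1 (hρ.trans_lt (hJρ _ hX).1)
    refine ⟨norm_smul_inv_norm (𝕜 := ℝ) hX0, ?_⟩
    rw [smul_inv_smul₀ (norm_ne_zero_iff.2 hX0)]
  obtain ⟨hn₀, hX₀⟩ := hunit X₀ h₀
  obtain ⟨hn₁, hX₁⟩ := hunit X₁ h₁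
  set n₀ := ‖X₀.1‖⁻¹ • X₀.1
  set n₁ := ‖X₁.1‖⁻¹ • X₁.1
  have step1 := isJoinable_radial hρ hJ hJρ h₀ hs hn₀ X₀.2
  have step2 := step1.trans hg (isJoinable_spherical hρ (hJρ s hs).1 h hn₀ hn₁ _)
  have step3 := step2.trans hg (isJoinable_translation hρ hJ hJρ hs hs' h h' hK hn₁ _
    (X₁.2 - (radialShift ‖X₁.1‖ - radialShift s) • n₁))
  have step4 := step3.trans hg (isJoinable_radial hρ hJ hJρ hs h₁ hn₁ _)
  rw [sub_add_cancel] at step4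
  rw [hX₀, hX₁]
  exact step4

theorem isControllableWithin_lt (hρ : 0 ≤ ρ) :
    IsControllableWithin tracerField (tracerStates ρ)
      {X ∈ tracerStates ρ | ‖X.1‖ < 3 / 2} :=
  isControllableWithin_of_isJoinable fun _ h₀ _ h₁ =>
    isJoinable_of_norm_mem hρ isOpen_Ioo ordConnected_Ioo (fun _ hs => ⟨hs.1, hs.2.ne⟩) h₀ h₁

theorem isControllableWithin_gt (hρ : 0 ≤ ρ) :
    IsControllableWithin tracerField (tracerStates ρ)
      {X ∈ tracerStates ρ | 3 / 2 < ‖X.1‖} :=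
  isControllableWithin_of_isJoinable fun _ h₀ _ h₁ =>
    isJoinable_of_norm_mem hρ (isOpen_Ioi.inter isOpen_Ioi)
      (ordConnected_Ioi.inter ordConnected_Ioi) (J := Ioi ρ ∩ Ioi (3 / 2))
      (fun _ hs => ⟨hs.1, (mem_Ioi.1 hs.2).ne'⟩) h₀ h₁

theorem IsControllableWithin.mono {ι E : Type*} [Fintype ι] [NormedAddCommGroup E]
    [NormedSpace ℝ E] {g : ι → E → E} {P Q Q' : Set E} (h : IsControllableWithin g P Q')
    (hQ : Q ⊆ Q') : IsControllableWithin g P Q :=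
  fun X₀ h₀ X₁ h₁ => h X₀ (hQ h₀) X₁ (hQ h₁)

theorem isControllableWithin_of_isPreconnected (hρ : 0 ≤ ρ) {Q : Set TracerState}
    (hQ : Q ⊆ {X ∈ tracerStates ρ | ‖X.1‖ ≠ 3 / 2}) (hc : IsPreconnected Q) :
    IsControllableWithin tracerField (tracerStates ρ) Q := by
  have hn : Continuous fun X : TracerState => ‖X.1‖ := continuous_fst.norm
  have hsub := hc.subset_or_subset (u := {X : TracerState | ‖X.1‖ < 3 / 2})
    (v := {X : TracerState | 3 / 2 < ‖X.1‖}) (isOpen_lt hn continuous_const)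
    (isOpen_lt continuous_const hn)
    (disjoint_left.2 fun X (h : ‖X.1‖ < 3 / 2) (h' : 3 / 2 < ‖X.1‖) => h.not_gt h')
    fun X hX => (hQ hX).2.lt_or_gt
  rcases hsub with h | h
  · exact (isControllableWithin_lt hρ).mono fun X hX => ⟨(hQ hX).1, h hX⟩
  · exact (isControllableWithin_gt hρ).mono fun X hX => ⟨(hQ hX).1, h hX⟩

end Moves

end

theorem mainTheorem1 (ρ : ℝ) (hρ : 0 ≤ ρ) :
    -- the controllable state set
    controllableStateSet tracerField (tracerStates ρ) =
        {X ∈ tracerStates ρ | ‖X.1‖ ≠ 3 / 2} ∧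
    -- controllability within every connected subset of it
    (∀ Q : Set TracerState, Q ⊆ {X ∈ tracerStates ρ | ‖X.1‖ ≠ 3 / 2} → IsPreconnected Q →
        IsControllableWithin tracerField (tracerStates ρ) Q) ∧
    -- in particular on either side of the sphere of radius 3/2
    IsControllableWithin tracerField (tracerStates ρ) {X ∈ tracerStates ρ | ‖X.1‖ < 3 / 2} ∧
    IsControllableWithin tracerField (tracerStates ρ) {X ∈ tracerStates ρ | 3 / 2 < ‖X.1‖} ∧
    -- evolution of the squared distance, for every control
    (∀ (T : ℝ) (f : ℝ → E3) (X : ℝ → TracerState), 0 < T →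
        IsTrajectory tracerField (tracerStates ρ) T f X →
        (∀ᵐ t ∂(volume.restrict (Icc 0 T)),
          HasDerivAt (fun s => ‖(X s).1‖ ^ 2)
            ((3 - 2 * ‖(X t).1‖) / ‖(X t).1‖ * inner ℝ (X t).1 (f t)) t) ∧
        -- a tracer that is at distance 3/2 at some time is at this distance at all times
        ((∃ t₀ ∈ Icc 0 T, ‖(X t₀).1‖ = 3 / 2) → ∀ t ∈ Icc 0 T, ‖(X t).1‖ = 3 / 2)) ∧
    -- no controllability at distance 3/2
    (∀ Q ⊆ tracerStates ρ, (∃ X₀ ∈ Q, ‖X₀.1‖ = 3 / 2) → (∃ X₁ ∈ Q, ‖X₁.1‖ ≠ 3 / 2) →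
        ¬ IsControllableWithin tracerField (tracerStates ρ) Q) ∧
    (∀ X₀ ∈ tracerStates ρ, ‖X₀.1‖ = 3 / 2 → ∀ U ∈ 𝓝 X₀,
        ¬ IsControllableWithin tracerField (tracerStates ρ) (U ∩ tracerStates ρ)) ∧
    -- orders of brackets needed, at an arbitrary state with `r ≠ 0`
    (∀ X : TracerState, X.1 ≠ 0 →
        (bracketSpanUpTo tracerField 3 X = ⊤ ↔ ‖X.1‖ ≠ 3 / 2 ∧ ‖X.1‖ ≠ 9 / 8) ∧
        (bracketSpanUpTo tracerField 4 X = ⊤ ↔ ‖X.1‖ ≠ 3 / 2)) ∧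
    -- explicit spanning brackets at the reduced configurations, where `r` is along the x axis
    (∀ (d : ℝ) (x : E3) (X : TracerState), 0 < d → X = (EuclideanSpace.single 0 d, x) →
        (Submodule.span ℝ {tracerField 0 X, tracerField 1 X, tracerField 2 X,
            gBr 0 1 X, gBr 0 2 X, gBr₃ 1 0 1 X} = ⊤ ↔ d ≠ 3 / 2 ∧ d ≠ 9 / 8) ∧
        (d = 9 / 8 →
          Submodule.span ℝ {tracerField 0 X, tracerField 1 X, tracerField 2 X,
            gBr₃ 0 0 1 X, gBr₃ 0 0 2 X, gBr₄ 1 0 0 1 X} = ⊤ ∧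
          Submodule.span ℝ {tracerField 0 X, tracerField 1 X, tracerField 2 X,
            gBr₃ 0 0 1 X, gBr₃ 0 0 2 X, gBr₄ 0 1 0 1 X} = ⊤)) := by
  refine ⟨controllableStateSet_tracerField hρ,
    fun Q hQ hc => isControllableWithin_of_isPreconnected hρ hQ hc,
    isControllableWithin_lt hρ, isControllableWithin_gt hρ, fun T f X hT hX => ⟨?_, ?_⟩,
    fun Q _ ⟨X₀, h₀, hX₀⟩ ⟨X₁, h₁, hX₁⟩ => not_isControllableWithin hρ h₀ hX₀ h₁ hX₁,
    fun X₀ h₀ hX₀ U hU => not_isControllableWithin_nhds hρ h₀ hX₀ hU,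
    fun X hX => ⟨bracketSpanUpTo_three_eq_top_iff hX, bracketSpanUpTo_four_eq_top_iff hX⟩,
    fun d x X hd hX => ⟨span_reduced_eq_top_iff hd (by rw [hX]), fun hd' => ⟨?_, ?_⟩⟩⟩
  · exact (ae_restrict_iff' measurableSet_Icc).2 (hX.ae_hasDerivAt_norm_sq hρ hT.le)
  · rintro ⟨t₀, ht₀, h0⟩
    exact hX.norm_eq_of_norm_eq hρ hT.le ht₀ h0
  · subst hd' hX
    exact span_reduced_nine_eighths_eq_top rfl (by simp [rotGen])
  · subst hd' hX
    exact span_reduced_nine_eighths_eq_top rfl (by simp [rotGen])
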